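/- **Absorbing Lemma.** All logarithms are natural. Let $D$ be a digraph with vertex set $V(D)$. For $v\in V(D)$ and $Y\subseteq V(D)$ let $d^{\pm}(v,Y)$ be the minimum of the number of out-neighbours and the number of in-neighbours of $v$ in $Y$; let $e(X,Y)$ be the number of arcs $(x,y)$ with $x\in X$, $y\in Y$, and let $e(X)=e(X,X)$. For $\alpha,p>0$, a digraph $D$ on $n$ vertices is called *$(n,\alpha,p)$-pseudorandom* if - (P1) $d^{\pm}(v,V(D))\ge (1/2+2\alpha)np$ for every $v\in V(D)$; - (P2) $e(X)\le |X|\log^{2.1}n$ for every $X\subseteq V(D)$ with $|X|\le \frac{\log^2 n}{p}$; - (P3) $e(X,Y)\le (1+\alpha/2)|X||Y|p$ for all disjoint $X,Y\subseteq V(D)$ with $|X|,|Y|\ge \frac{\log^{1.1}n}{p}$. Let $\alpha>0$ be a constant, let $p=p(n)$ satisfy $p=\omega\left(\frac{\log^8 n}{n}\right)$, and let $\varepsilon(n)\to 0$. Then for all sufficiently large $n$ the following holds for every $(n,\alpha,p)$-pseudorandom digraph $D$ and every partition $V(D)=V_1\cup\dots\cup V_5$ such that - (Q1) $d^{\pm}(v,V_i)\ge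 (1/2+\alpha)|V_i|p$ for every $v\in V(D)$ and every $i\in\{1,\dots,5\}$; - (Q2) $\left||V_1|-\frac{n}{\log^3 n}\right|\le \varepsilon(n)\frac{n}{\log^3 n}$ (that is, $|V_1|=(1+o(1))\,n/\log^3 n$), and $|V_2|,|V_3|,|V_4|\in\left(\frac{\alpha}{5(1+2\alpha)}n,\ \frac{\alpha}{4(1+2\alpha)}n\right)$. There is a directed path $P^*$ in $D$ with $V(P^*)\subseteq V_2\cup V_3\cup V_4$ such that for every $W\subseteq V_1$ there is a directed path $P^*_W$ in $D$ with $V(P^*_W)=V(P^*)\cup W$ and with the same first vertex and the same last vertex as $P^*$. -/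

import Mathlib

open Filter

noncomputable section

namespace PseudorandomDigraph

variable {V : Type*}

/-- The out-neighbourhood `N⁺(x, Y)` of a vertex `x` in `Y`. -/
def outNbrs (D : Digraph V) (x : V) (Y : Finset V) : Finset V :=
  open Classical in Y.filter (fun y => D.Adj x y)

/-- The in-neighbourhood `N⁻(x, Y)` of a vertex `x` in `Y`. -/
def inNbrs (D : Digraph V) (x : V) (Y : Finset V) : Finset V :=
  open Classical in Y.filter (fun y => D.Adj y x)

/-- `d^±(x, Y)`, the smaller of the out-degree and the in-degree of `x` in `Y`. -/
def minSemidegree (D : Digraph V) (x : V) (Y : Finset V) : ℕ :=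
  min (outNbrs D x Y).card (inNbrs D x Y).card

/-- `e(X, Y)`, the number of arcs from a vertex of `X` to a vertex of `Y`. -/
def arcCount (D : Digraph V) (X Y : Finset V) : ℕ :=
  open Classical in ((X ×ˢ Y).filter (fun a => D.Adj a.1 a.2)).card

/-- `(n, α, p)`-pseudorandom digraphs. -/
structure IsPseudorandom [Fintype V] (D : Digraph V) (n : ℕ) (α p : ℝ) : Prop where
  card_eq : Fintype.card V = n
  min_degree : ∀ v : V,
    (1 / 2 + 2 * α) * n * p ≤ (minSemidegree D v Finset.univ : ℝ)
  few_arcs : ∀ X : Finset V, (X.card : ℝ) ≤ Real.log n ^ 2 / p →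
    (arcCount D X X : ℝ) ≤ X.card * Real.log n ^ (2.1 : ℝ)
  arcs_between : ∀ X Y : Finset V, Disjoint X Y →
    Real.log n ^ (1.1 : ℝ) / p ≤ (X.card : ℝ) →
    Real.log n ^ (1.1 : ℝ) / p ≤ (Y.card : ℝ) →
    (arcCount D X Y : ℝ) ≤ (1 + α / 2) * X.card * Y.card * p

/-- The partition `V₁, …, V₅` of the vertex set, as `P 0, …, P 4`. The number `ε` bounds the
relative error in `|V₁| = (1 + o(1)) n / log³ n`. -/
structure IsGoodPartition [Fintype V] (D : Digraph V) (n : ℕ) (α p ε : ℝ)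
    (P : Fin 5 → Finset V) : Prop where
  disjoint : ∀ i j, i ≠ j → Disjoint (P i) (P j)
  cover : ∀ v : V, ∃ i, v ∈ P i
  min_degree : ∀ (v : V) (i : Fin 5),
    (1 / 2 + α) * (P i).card * p ≤ (minSemidegree D v (P i) : ℝ)
  card_first : |((P 0).card : ℝ) - n / Real.log n ^ 3| ≤ ε * (n / Real.log n ^ 3)
  card_middle : ∀ i ∈ ({1, 2, 3} : Finset (Fin 5)),
    ((P i).card : ℝ) ∈
      Set.Ioo (α / (5 * (1 + 2 * α)) * n) (α / (4 * (1 + 2 * α)) * n)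

/-- A (nonempty) directed path, as the list of its distinct vertices in order. -/
def IsDirectedPath (D : Digraph V) (l : List V) : Prop :=
  l ≠ [] ∧ l.Nodup ∧ l.IsChain D.Adj

/-- Both lists have the same first entry and the same last entry. -/
def SameEndpoints (l l' : List V) : Prop :=
  l.head? = l'.head? ∧ l.getLast? = l'.getLast?

end PseudorandomDigraph

end

noncomputable section

namespace PseudorandomDigraph

/-! An absorber for one vertex x of V₁ is an alternating cycle x → y₀ ← z₀ → y₁ ← z₁ → … → y₂ₕ ← z₂ₕ
→ x together with disjoint paths from yᵢ to zᵢ₊₁, where z₂ₕ₊₁ is an extra vertex. Let block i be the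
path from yᵢ to zᵢ₊₁. Starting at z₀ and entering the blocks in their natural order uses the arcs zᵢ
→ yᵢ and misses x. Taking the odd blocks first, then x, then the even blocks uses the arcs zᵢ → yᵢ₊₁
and the two arcs at x. Both routes run from z₀ to z₂ₕ₊₁. If z₂ₕ₊₁ is the vertex z₀ of the next
cycle, the absorbers of all vertices of V₁ form one path in which each x can be switched on or off
independently (`exists_absorption`).

The cycles are found in V₂, the linking paths in V₃, and V₄ supplies only the final vertex. Both
come from one connecting lemma, `Sparse.exists_disjoint_paths`, for paths of fixed length with
prescribed arc orientations; a cycle through x is such a path from x to x.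

For a single pair (`Sparse.exists_path`), the sets of reachable vertices double at each step from
either end, because small sets span few arcs. Once they have size T, one more step reaches more than
half of K, since degrees exceed (1/2 + α/2)|K|p while the density between large sets is at most (1 +
α/2)p. The two halves meet.

For many pairs at once, the Hall-type `exists_disjoint_choice` leaves only this to show: no set U of
size proportional to |I| times the path length blocks all pairs of a family I. By
`Sparse.exists_closure`, U can be enlarged by fewer than about |I|/2 vertices so that all vertices
outside lose few neighbours. Some pair then avoids the enlargement and can be joined in what remains
of K. -/

/-! ### Disjoint representatives in hypergraphs. -/

/-- One round of the alternating search behind `exists_disjoint_choice`: after changing the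
matching `M` only outside `I`, some index of `I` has a set avoiding `U` and the matching. -/
theorem exists_free_set {ι V : Type*} [DecidableEq ι] [DecidableEq V]
    (E : ι → Set (Finset V)) (r : ℕ) (hr : ∀ i, ∀ e ∈ E i, e.card ≤ r) (J I₀ : Finset ι)
    (hE : ∀ I ⊆ I₀, I.Nonempty → ∀ U : Finset V, U.card ≤ 2 * r * I.card →
      ∃ i ∈ I, ∃ e ∈ E i, Disjoint e U) (hJ : J ⊆ I₀) :
    ∀ (N : ℕ) (I : Finset ι) (U : Finset V) (M : ι → Finset V),
      (J \ I).card ≤ N → I ⊆ I₀ → I.Nonempty → U.card + 2 * r ≤ 2 * r * I.card →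
      (∀ j ∈ J, M j ∈ E j) → (∀ i ∈ J, ∀ j ∈ J, i ≠ j → Disjoint (M i) (M j)) →
      (∀ j ∈ J, j ∈ I → M j ⊆ U) → (∀ j ∈ J, j ∉ I → Disjoint (M j) U) →
      ∃ M' : ι → Finset V, (∀ j ∈ J, M' j ∈ E j) ∧
        (∀ i ∈ J, ∀ j ∈ J, i ≠ j → Disjoint (M' i) (M' j)) ∧
        (∀ j ∈ J, j ∈ I → M' j = M j) ∧ (∀ j ∈ J, j ∉ I → Disjoint (M' j) U) ∧
        ∃ i ∈ I, ∃ e ∈ E i, Disjoint e U ∧ ∀ j ∈ J, Disjoint (M' j) e := by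
  intro N
  induction N with
  | zero =>
    intro I U M hN hI hne hU hM hMd hMI hMU
    obtain ⟨i, hi, e, he, heU⟩ := hE I hI hne U (by omega)
    have hsub : J ⊆ I := by
      rw [← Finset.sdiff_eq_empty_iff_subset, ← Finset.card_eq_zero]; omega
    exact ⟨M, hM, hMd, fun _ _ _ => rfl, hMU, i, hi, e, he, heU, fun j hj =>
      (heU.mono_right (hMI j hj (hsub hj))).symm⟩
  | succ N ih =>
    intro I U M hN hI hne hU hM hMd hMI hMU
    obtain ⟨i, hi, e, he, heU⟩ := hE I hI hne U (by omega)
    -- Inner induction on the number of matching sets that meet e; the outer induction is on the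
    -- number of indices of J outside I.
    have key : ∀ (b : ℕ) (M₁ : ι → Finset V), (∀ j ∈ J, M₁ j ∈ E j) →
        (∀ i ∈ J, ∀ j ∈ J, i ≠ j → Disjoint (M₁ i) (M₁ j)) →
        (∀ j ∈ J, j ∈ I → M₁ j = M j) → (∀ j ∈ J, j ∉ I → Disjoint (M₁ j) U) →
        (J.filter (fun j => ¬ Disjoint (M₁ j) e)).card ≤ b →
        ∃ M' : ι → Finset V, (∀ j ∈ J, M' j ∈ E j) ∧
        (∀ i ∈ J, ∀ j ∈ J, i ≠ j → Disjoint (M' i) (M' j)) ∧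
        (∀ j ∈ J, j ∈ I → M' j = M j) ∧ (∀ j ∈ J, j ∉ I → Disjoint (M' j) U) ∧
        ∃ i ∈ I, ∃ e ∈ E i, Disjoint e U ∧ ∀ j ∈ J, Disjoint (M' j) e := by
      intro b
      induction b with
      | zero =>
        intro M₁ h1 h2 h3 h4 h5
        refine ⟨M₁, h1, h2, h3, h4, i, hi, e, he, heU, fun j hj => ?_⟩
        by_contra hcon
        have : j ∈ J.filter (fun j => ¬ Disjoint (M₁ j) e) := by simp [hj, hcon]
        have := Finset.card_pos.2 ⟨j, this⟩
        omega
      | succ b ihb =>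
        intro M₁ h1 h2 h3 h4 h5
        set B := J.filter (fun j => ¬ Disjoint (M₁ j) e) with hB
        rcases B.eq_empty_or_nonempty with hB0 | hBne
        · exact ihb M₁ h1 h2 h3 h4 (by rw [← hB, hB0]; simp)
        have hBJ : B ⊆ J := Finset.filter_subset _ _
        have hBI : Disjoint I B := by
          rw [Finset.disjoint_left]
          intro j hjI hjB
          have hj := Finset.mem_filter.1 hjB
          apply hj.2
          rw [h3 j hj.1 hjI]
          exact (heU.mono_right (hMI j hj.1 hjI)).symm
        have hcard : (I ∪ B).card = I.card + B.card := Finset.card_union_of_disjoint hBI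
        have hBpos : 0 < B.card := Finset.card_pos.2 hBne
        have hbi : (B.biUnion M₁).card ≤ B.card * r :=
          Finset.card_biUnion_le_card_mul _ _ _ (fun j hj => hr j _ (h1 j (hBJ hj)))
        -- The blockers B join I, while e and their sets join U. This adds at most r + r|B| ≤ 2r|B|
        -- vertices, as B is nonempty, so the size condition survives.
        obtain ⟨M₂, g1, g2, g3, g4, i', hi', e', he', heU', hMe'⟩ :=
          ih (I ∪ B) (U ∪ e ∪ B.biUnion M₁) M₁ (by
            have : J \ (I ∪ B) ⊂ J \ I := by
              rw [Finset.ssubset_iff_of_subset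
                (Finset.sdiff_subset_sdiff le_rfl Finset.subset_union_left)]
              obtain ⟨j, hj⟩ := hBne
              exact ⟨j, Finset.mem_sdiff.2 ⟨hBJ hj, fun h => Finset.disjoint_left.1 hBI h hj⟩,
                by simp [hj]⟩
            have := Finset.card_lt_card this
            omega) (Finset.union_subset hI (hBJ.trans hJ)) (hne.mono Finset.subset_union_left)
            (by
              have e1 := Finset.card_union_le (U ∪ e) (B.biUnion M₁)
              have e2 := Finset.card_union_le U e
              have e3 := hr i e he
              rw [hcard]
              nlinarith) h1 h2
            (by
              intro j hj hjI
              rcases Finset.mem_union.1 hjI with h | h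
              · rw [h3 j hj h]
                exact (hMI j hj h).trans (Finset.subset_union_left.trans Finset.subset_union_left)
              · exact (Finset.subset_biUnion_of_mem M₁ h).trans Finset.subset_union_right)
            (by
              intro j hj hjI
              rw [Finset.mem_union, not_or] at hjI
              rw [Finset.disjoint_union_right, Finset.disjoint_union_right,
                Finset.disjoint_biUnion_right]
              refine ⟨⟨h4 j hj hjI.1, ?_⟩, fun k hk => h2 j hj k (hBJ hk) ?_⟩
              · by_contra hcon
                exact hjI.2 (Finset.mem_filter.2 ⟨hj, hcon⟩)
              · rintro rfl
                exact hjI.2 hk)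
        rw [Finset.disjoint_union_right, Finset.disjoint_union_right] at heU'
        have g4' : ∀ j ∈ J, j ∉ I → Disjoint (M₂ j) U := by
          intro j hj hjI
          by_cases hjB : j ∈ B
          · rw [g3 j hj (Finset.mem_union_right _ hjB)]
            exact h4 j hj hjI
          · exact (g4 j hj (by simp [hjI, hjB])).mono_right
              (Finset.subset_union_left.trans Finset.subset_union_left)
        have g3' : ∀ j ∈ J, j ∈ I → M₂ j = M j := fun j hj hjI => by
          rw [g3 j hj (Finset.mem_union_left _ hjI), h3 j hj hjI]
        by_cases hiI : i' ∈ I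
        · exact ⟨M₂, g1, g2, g3', g4', i', hiI, e', he', heU'.1.1, hMe'⟩
        have hiB : i' ∈ B := (Finset.mem_union.1 hi').resolve_left hiI
        -- The free set found belongs to a blocker i'. Giving i' this set, which avoids e, removes
        -- it from the blockers; no new one appears, since the sets of indices outside I ∪ B avoid
        -- the enlarged U, which contains e.
        refine ihb (Function.update M₂ i' e') ?_ ?_ ?_ ?_ ?_
        · intro j hj
          by_cases h : j = i'
          · subst h; simpa using he'
          · simpa [h] using g1 j hj
        · intro j hj k hk hjk
          by_cases h : j = i'
          · subst h
            rw [Function.update_self, Function.update_of_ne (Ne.symm hjk)]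
            exact (hMe' k hk).symm
          · by_cases h' : k = i'
            · subst h'
              rw [Function.update_self, Function.update_of_ne h]
              exact hMe' j hj
            · rw [Function.update_of_ne h, Function.update_of_ne h']
              exact g2 j hj k hk hjk
        · intro j hj hjI
          rw [Function.update_of_ne (by rintro rfl; exact hiI hjI)]
          exact g3' j hj hjI
        · intro j hj hjI
          by_cases h : j = i'
          · subst h; simpa using heU'.1.1
          · rw [Function.update_of_ne h]
            exact g4' j hj hjI
        · have hlt : J.filter (fun j => ¬ Disjoint (Function.update M₂ i' e' j) e) ⊆
              B.erase i' := by
            intro j hj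
            rw [Finset.mem_filter] at hj
            have hji : j ≠ i' := by
              rintro rfl
              apply hj.2
              rw [Function.update_self]
              exact heU'.1.2
            rw [Function.update_of_ne hji] at hj
            rw [Finset.mem_erase]
            refine ⟨hji, ?_⟩
            by_contra hjB
            by_cases hjI : j ∈ I
            · apply hj.2
              rw [g3' j hj.1 hjI]
              exact (heU.mono_right (hMI j hj.1 hjI)).symm
            · exact hj.2 ((g4 j hj.1 (by simp [hjI, hjB])).mono_right
                (Finset.subset_union_right.trans Finset.subset_union_left))
          have := Finset.card_le_card hlt
          rw [Finset.card_erase_of_mem hiB] at this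
          omega
    exact key _ M hM hMd (fun _ _ _ => rfl) hMU le_rfl

/-- A Hall-type theorem for hypergraphs: if no subfamily `I` of the families `E i` has a cover
of at most `2 r |I|` vertices, then one can choose pairwise disjoint members. -/
theorem exists_disjoint_choice {ι V : Type*} [DecidableEq ι] [DecidableEq V]
    (E : ι → Set (Finset V)) (r : ℕ) (hr : ∀ i, ∀ e ∈ E i, e.card ≤ r) (S : Finset ι)
    (hE : ∀ I ⊆ S, I.Nonempty → ∀ U : Finset V, U.card ≤ 2 * r * I.card →
      ∃ i ∈ I, ∃ e ∈ E i, Disjoint e U) :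
    ∃ M : ι → Finset V, (∀ j ∈ S, M j ∈ E j) ∧
      ∀ i ∈ S, ∀ j ∈ S, i ≠ j → Disjoint (M i) (M j) := by
  induction S using Finset.induction_on with
  | empty => exact ⟨fun _ => ∅, by simp, by simp⟩
  | insert a J haJ ih =>
    obtain ⟨M, hM, hMd⟩ := ih (fun I hI => hE I (hI.trans (Finset.subset_insert _ _)))
    obtain ⟨M', h1, h2, -, -, i, hi, e, he, -, hd⟩ :=
      exists_free_set E r hr J (insert a J) hE (Finset.subset_insert _ _) _ {a} ∅ M le_rfl
        (by simp) (by simp) (by simp) hM hMd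
        (fun j hj hja => absurd (Finset.mem_singleton.1 hja ▸ hj) haJ) (by simp)
    rw [Finset.mem_singleton] at hi
    subst hi
    refine ⟨Function.update M' i e, ?_, ?_⟩
    · intro j hj
      by_cases h : j = i
      · subst h; simpa using he
      · rw [Function.update_of_ne h]
        exact h1 j ((Finset.mem_insert.1 hj).resolve_left h)
    · intro j hj k hk hjk
      by_cases h : j = i
      · subst h
        rw [Function.update_self, Function.update_of_ne (Ne.symm hjk)]
        exact (hd k ((Finset.mem_insert.1 hk).resolve_left (Ne.symm hjk))).symm
      · have hj' := (Finset.mem_insert.1 hj).resolve_left h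
        by_cases h' : k = i
        · subst h'
          rw [Function.update_self, Function.update_of_ne h]
          exact hd j hj'
        · rw [Function.update_of_ne h, Function.update_of_ne h']
          exact h2 j hj' k ((Finset.mem_insert.1 hk).resolve_left h') hjk

/-! ### Arc counts and closures of small sets. -/

open scoped Classical

variable {V : Type*}

/-- The number of pairs in `X × Y` related by `r`. -/
def relCount (r : V → V → Prop) (X Y : Finset V) : ℕ :=
  ∑ x ∈ X, (Y.filter (r x)).card

/-- The two upper bounds on arc counts in a pseudorandom digraph, for a general relation and
with general parameters. -/
structure Sparse (r : V → V → Prop) (Λ lam T γ : ℝ) : Prop where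
  few : ∀ X : Finset V, (X.card : ℝ) ≤ Λ → (relCount r X X : ℝ) ≤ lam * X.card
  between : ∀ X Y : Finset V, Disjoint X Y → T ≤ (X.card : ℝ) → T ≤ (Y.card : ℝ) →
    (relCount r X Y : ℝ) ≤ γ * X.card * Y.card

theorem relCount_flip (r : V → V → Prop) (X Y : Finset V) :
    relCount (flip r) X Y = relCount r Y X := by
  unfold relCount
  exact (Finset.sum_card_bipartiteAbove_eq_sum_card_bipartiteBelow r).symm

/-- Both conditions are symmetric under reversal of arcs. This is what allows arbitrary orientations
along the paths. -/
theorem Sparse.swap {r : V → V → Prop} {Λ lam T γ : ℝ} (h : Sparse r Λ lam T γ) :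
    Sparse (flip r) Λ lam T γ where
  few X hX := by rw [relCount_flip]; exact h.few X hX
  between X Y hd hX hY := by
    rw [relCount_flip]
    exact (h.between Y X hd.symm hY hX).trans_eq (by ring)

theorem relCount_mono {r : V → V → Prop} {X X' Y Y' : Finset V} (hX : X ⊆ X') (hY : Y ⊆ Y') :
    relCount r X Y ≤ relCount r X' Y' := by
  unfold relCount
  calc ∑ x ∈ X, (Y.filter (r x)).card ≤ ∑ x ∈ X, (Y'.filter (r x)).card :=
        Finset.sum_le_sum fun x _ => Finset.card_le_card (Finset.filter_subset_filter _ hY)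
    _ ≤ _ := Finset.sum_le_sum_of_subset hX

theorem relCount_union_le (r : V → V → Prop) (X Y Z : Finset V) :
    relCount r X (Y ∪ Z) ≤ relCount r X Y + relCount r X Z := by
  unfold relCount
  rw [← Finset.sum_add_distrib]
  refine Finset.sum_le_sum fun x _ => ?_
  rw [Finset.filter_union]
  exact Finset.card_union_le _ _

theorem relCount_insert (r : V → V → Prop) {v : V} {X : Finset V} (hv : v ∉ X) (Y : Finset V) :
    relCount r (insert v X) Y = (Y.filter (r v)).card + relCount r X Y := by
  unfold relCount
  rw [Finset.sum_insert hv]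

theorem le_relCount {r : V → V → Prop} {X Y : Finset V} {d : ℝ}
    (h : ∀ x ∈ X, d ≤ ((Y.filter (r x)).card : ℝ)) : d * X.card ≤ (relCount r X Y : ℝ) := by
  unfold relCount
  push_cast
  have := Finset.card_nsmul_le_sum X (fun x => ((Y.filter (r x)).card : ℝ)) d h
  rw [nsmul_eq_mul] at this
  linarith

/-- A set of related vertices sends few arcs to itself and to a set that is not much larger. -/
theorem Sparse.relCount_union_self_le [Fintype V] {r : V → V → Prop} {Λ lam T γ C u b : ℝ}
    (h : Sparse r Λ lam T γ) (hT : 1 ≤ T) (hΛ : 3 * T ≤ Λ) (hlam : 0 ≤ lam) (hγ : 0 ≤ γ)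
    (hu : u + 2 * T ≤ Fintype.card V)
    (hb1 : lam + γ * u ≤ b) (hb2 : 2 * lam ≤ b) (hb3 : lam * (1 + C) ≤ b)
    (hb4 : lam + 2 * γ * T * C ≤ b)
    {X U : Finset V} (hd : Disjoint X U) (hX : (X.card : ℝ) ≤ 2 * T)
    (hU : (U.card : ℝ) ≤ u) (hUX : (X.card : ℝ) < T → (U.card : ℝ) ≤ C * X.card) :
    (relCount r X (U ∪ X) : ℝ) ≤ b * X.card := by
  have hx0 : (0 : ℝ) ≤ X.card := by positivity
  have hu0 : (0 : ℝ) ≤ U.card := by positivity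
  have hun : ((U ∪ X).card : ℝ) ≤ U.card + X.card := by exact_mod_cast Finset.card_union_le U X
  have hmono : (relCount r X (U ∪ X) : ℝ) ≤ relCount r (U ∪ X) (U ∪ X) := by
    exact_mod_cast relCount_mono Finset.subset_union_right le_rfl
  have hsplit : (relCount r X (U ∪ X) : ℝ) ≤ relCount r X U + relCount r X X := by
    exact_mod_cast relCount_union_le r X U X
  have hXX := h.few X (by linarith)
  rcases lt_or_ge (U.card : ℝ) T with hUT | hUT
  · have := h.few (U ∪ X) (by linarith)
    have h1 : (relCount r X (U ∪ X) : ℝ) ≤ lam * (U.card + X.card) :=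
      hmono.trans (this.trans (mul_le_mul_of_nonneg_left hun hlam))
    rcases lt_or_ge (X.card : ℝ) T with hXT | hXT
    · have := mul_le_mul_of_nonneg_left (hUX hXT) hlam
      have := mul_le_mul_of_nonneg_right hb3 hx0
      linarith
    · have := mul_le_mul_of_nonneg_left (hUT.le.trans hXT) hlam
      have := mul_le_mul_of_nonneg_right hb2 hx0
      linarith
  · rcases lt_or_ge (X.card : ℝ) T with hXT | hXT
    -- X is too small for `between`, so it is padded outside U to size ⌈T⌉ ≤ 2T; `hu` leaves room
    -- for this. The loss is harmless because |U| ≤ C|X| here.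
    · obtain ⟨X', hXX', hX'U, hX'c⟩ :=
        Finset.exists_subsuperset_card_eq (s := X) (t := Uᶜ) (n := ⌈T⌉₊)
          (by rw [Finset.subset_compl_iff_disjoint_right]; exact hd)
          (by
            have := (Nat.le_ceil T)
            exact_mod_cast hXT.le.trans this)
          (by
            rw [Finset.card_compl, Nat.le_sub_iff_add_le (Finset.card_le_univ _)]
            have := (Nat.ceil_lt_add_one (by linarith : (0 : ℝ) ≤ T))
            have : ((⌈T⌉₊ + U.card : ℕ) : ℝ) ≤ Fintype.card V := by push_cast; linarith
            exact_mod_cast this)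
      rw [Finset.subset_compl_iff_disjoint_right] at hX'U
      have hc1 : T ≤ (X'.card : ℝ) := by rw [hX'c]; exact Nat.le_ceil T
      have hc2 : (X'.card : ℝ) ≤ 2 * T := by
        rw [hX'c]
        have := (Nat.ceil_lt_add_one (by linarith : (0 : ℝ) ≤ T))
        linarith
      have h1 := h.between X' U hX'U hc1 hUT
      have h2 : (relCount r X U : ℝ) ≤ relCount r X' U := by
        exact_mod_cast relCount_mono hXX' le_rfl
      have h3 : γ * X'.card * U.card ≤ γ * (2 * T) * (C * X.card) := by
        have := hUX hXT
        gcongr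
      have := mul_le_mul_of_nonneg_right hb4 hx0
      nlinarith
    · have h1 := h.between X U hd hXT hUT
      have h3 : γ * X.card * U.card ≤ γ * X.card * u := by gcongr
      have := mul_le_mul_of_nonneg_right hb1 hx0
      nlinarith

/-- A small set `U` can be enlarged by few vertices so that no vertex outside has more than `q`
neighbours in the enlarged set. -/
theorem Sparse.exists_closure [Fintype V] {r : V → V → Prop} {Λ lam T γ C u b q : ℝ}
    (h : Sparse r Λ lam T γ) (hT : 1 ≤ T) (hΛ : 3 * T ≤ Λ) (hlam : 0 ≤ lam) (hγ : 0 ≤ γ)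
    (hu : u + 2 * T ≤ Fintype.card V)
    (hb1 : lam + γ * u ≤ b) (hb2 : 2 * lam ≤ b) (hb3 : lam * (1 + C) ≤ b)
    (hb4 : lam + 2 * γ * T * C ≤ b) (hq : 2 * b < q) {U : Finset V} {s : ℕ} (hs : 1 ≤ s)
    (hU : (U.card : ℝ) ≤ u) (hUs : (U.card : ℝ) ≤ C * s) :
    ∃ X : Finset V, Disjoint X U ∧ X.card < s ∧ ∀ v ∉ U ∪ X,
      (((U ∪ X).filter (r v)).card : ℝ) ≤ q ∧ (((U ∪ X).filter (flip r v)).card : ℝ) ≤ q := by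
  -- X is chosen maximal among sets sending on average at least q arcs per vertex (both directions
  -- together) to U ∪ X. An outside vertex with more than q neighbours in U ∪ X could be added,
  -- unless X has reached the size cap.
  set F : Finset (Finset V) := Finset.univ.filter (fun X => Disjoint X U ∧
    X.card ≤ min s ⌈T⌉₊ ∧
    q * X.card ≤ (relCount r X (U ∪ X) : ℝ) + relCount (flip r) X (U ∪ X)) with hF
  have hne : F.Nonempty := ⟨∅, by simp [hF, relCount]⟩
  obtain ⟨X, hXF, hmax⟩ := Finset.exists_max_image F Finset.card hne
  obtain ⟨-, hd, hXs, hXq⟩ := Finset.mem_filter.1 hXF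
  have hceil := (Nat.ceil_lt_add_one (by linarith : (0 : ℝ) ≤ T))
  -- At the cap, the arc estimate in both directions gives at most 2b|X| < q|X| arcs. If moreover
  -- |X| < T, the cap is s, which yields |U| ≤ C|X|.
  have hlt : X.card < min s ⌈T⌉₊ := by
    rcases hXs.lt_or_eq with h1 | h1
    · exact h1
    exfalso
    have hX2 : (X.card : ℝ) ≤ 2 * T := by
      have : (X.card : ℝ) ≤ ⌈T⌉₊ := by exact_mod_cast hXs.trans (min_le_right _ _)
      linarith
    have hUX : (X.card : ℝ) < T → (U.card : ℝ) ≤ C * X.card := by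
      intro h2
      have h3 : X.card < ⌈T⌉₊ := by exact_mod_cast h2.trans_le (Nat.le_ceil T)
      have h4 : X.card = s := by omega
      rwa [h4]
    have e1 := h.relCount_union_self_le hT hΛ hlam hγ hu hb1 hb2 hb3 hb4 hd hX2 hU hUX
    have e2 := h.swap.relCount_union_self_le hT hΛ hlam hγ hu hb1 hb2 hb3 hb4 hd hX2 hU hUX
    have hpos : 0 < X.card := by
      rw [h1, lt_min_iff]
      exact ⟨hs, Nat.ceil_pos.2 (by linarith)⟩
    have : (0 : ℝ) < X.card := by exact_mod_cast hpos
    nlinarith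
  refine ⟨X, hd, hlt.trans_le (min_le_left _ _), fun v hv => ?_⟩
  rw [Finset.mem_union, not_or] at hv
  by_contra hcon
  have hsum : q < (((U ∪ X).filter (r v)).card : ℝ) + ((U ∪ X).filter (flip r v)).card := by
    have h1 : (0 : ℝ) ≤ ((U ∪ X).filter (r v)).card := by positivity
    have h2 : (0 : ℝ) ≤ ((U ∪ X).filter (flip r v)).card := by positivity
    by_contra h3
    exact hcon ⟨by linarith, by linarith⟩
  have hmem : insert v X ∈ F := by
    refine Finset.mem_filter.2 ⟨Finset.mem_univ _, ?_, ?_, ?_⟩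
    · rw [Finset.disjoint_insert_left]
      exact ⟨hv.1, hd⟩
    · rw [Finset.card_insert_of_notMem hv.2]
      exact hlt
    · have hsub : U ∪ X ⊆ U ∪ insert v X :=
        Finset.union_subset_union le_rfl (Finset.subset_insert _ _)
      have key : ∀ r' : V → V → Prop, (((U ∪ X).filter (r' v)).card : ℝ) +
          relCount r' X (U ∪ X) ≤ relCount r' (insert v X) (U ∪ insert v X) := by
        intro r'
        have h1 : relCount r' (insert v X) (U ∪ X) ≤
          relCount r' (insert v X) (U ∪ insert v X) := relCount_mono le_rfl hsub
        rw [relCount_insert r' hv.2] at h1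
        exact_mod_cast h1
      have k1 := key r
      have k2 := key (flip r)
      rw [Finset.card_insert_of_notMem hv.2]
      push_cast
      linarith
  have := hmax _ hmem
  rw [Finset.card_insert_of_notMem hv.2] at this
  omega

/-! ### Expansion of neighbourhoods. -/

/-- The vertices of `S` that are related to some vertex of `L`. -/
def nbrSet (r : V → V → Prop) (L S : Finset V) : Finset V :=
  S.filter (fun w => ∃ u ∈ L, r u w)

theorem nbrSet_subset (r : V → V → Prop) (L S : Finset V) : nbrSet r L S ⊆ S :=
  Finset.filter_subset _ _

theorem relCount_le_union_nbrSet (r : V → V → Prop) (L F K : Finset V) :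
    relCount r L K ≤ relCount r L (F ∪ nbrSet r L (K \ F)) := by
  unfold relCount
  refine Finset.sum_le_sum fun x hx => Finset.card_le_card fun y hy => ?_
  rw [Finset.mem_filter] at hy ⊢
  refine ⟨?_, hy.2⟩
  by_cases hyF : y ∈ F
  · exact Finset.mem_union_left _ hyF
  · exact Finset.mem_union_right _
      (Finset.mem_filter.2 ⟨Finset.mem_sdiff.2 ⟨hy.1, hyF⟩, x, hx, hy.2⟩)

/-- Otherwise L, the forbidden set F and the new neighbours together have at most (1 + 12 + 2)|L|
vertices, yet span at least d|L| > 15 lam |L| arcs. -/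
theorem Sparse.two_mul_card_lt_nbrSet {r : V → V → Prop} {Λ lam T γ d : ℝ}
    (h : Sparse r Λ lam T γ) (hlam : 0 ≤ lam) {L F K : Finset V} (hL : L.Nonempty)
    (hd : ∀ x ∈ L, d ≤ ((K.filter (r x)).card : ℝ)) (hF : F.card ≤ 12 * L.card)
    (hLΛ : 15 * (L.card : ℝ) ≤ Λ) (hdl : 15 * lam < d) :
    2 * L.card < (nbrSet r L (K \ F)).card := by
  by_contra! hcon
  set Y := nbrSet r L (K \ F)
  set Z := L ∪ (F ∪ Y)
  have hZ : Z.card ≤ 15 * L.card := by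
    have e1 := Finset.card_union_le L (F ∪ Y)
    have e2 := Finset.card_union_le F Y
    change (L ∪ (F ∪ Y)).card ≤ _
    omega
  have hZ' : (Z.card : ℝ) ≤ 15 * L.card := by exact_mod_cast hZ
  have h1 := le_relCount hd
  have h2 : (relCount r L K : ℝ) ≤ relCount r Z Z := by
    exact_mod_cast (relCount_le_union_nbrSet r L F K).trans
      (relCount_mono Finset.subset_union_left Finset.subset_union_right)
  have h3 := h.few Z (hZ'.trans hLΛ)
  have h4 := mul_le_mul_of_nonneg_left hZ' hlam
  have h5 : (0 : ℝ) < L.card := by exact_mod_cast hL.card_pos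
  nlinarith

/-- L ∪ F spans at most 13 lam |L| arcs, so the remaining arcs from L go to the new neighbours Y,
and `between` bounds them by γ|L||Y|. With |Y| ≤ κ/2 this is less than d|L|. Here the constant 1/2
in the degree condition is used. -/
theorem Sparse.half_lt_card_nbrSet {r : V → V → Prop} {Λ lam T γ d κ : ℝ}
    (h : Sparse r Λ lam T γ) (hlam : 0 ≤ lam) (hγ : 0 ≤ γ) {L F K : Finset V} (hL : L.Nonempty)
    (hd : ∀ x ∈ L, d ≤ ((K.filter (r x)).card : ℝ)) (hF : F.card ≤ 12 * L.card)
    (hLΛ : 15 * (L.card : ℝ) ≤ Λ) (hdl : 15 * lam < d) (hLT : T ≤ L.card)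
    (hLF : Disjoint L (K \ F)) (hdκ : 13 * lam + γ * κ / 2 < d) :
    κ / 2 < (nbrSet r L (K \ F)).card := by
  by_contra! hcon
  have hbig := h.two_mul_card_lt_nbrSet hlam hL hd hF hLΛ hdl
  set Y := nbrSet r L (K \ F) with hY
  have hL0 : (0 : ℝ) < L.card := by exact_mod_cast hL.card_pos
  have hbig' : 2 * (L.card : ℝ) < Y.card := by exact_mod_cast hbig
  have hLY : Disjoint L Y := hLF.mono_right (Finset.filter_subset _ _)
  have h1 := h.between L Y hLY hLT (by linarith)
  have hZ : ((L ∪ F).card : ℝ) ≤ 13 * L.card := by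
    have e1 := Finset.card_union_le L F
    have : (L ∪ F).card ≤ 13 * L.card := by omega
    exact_mod_cast this
  have h2 := h.few (L ∪ F) (by linarith)
  have h3 : (relCount r L F : ℝ) ≤ relCount r (L ∪ F) (L ∪ F) := by
    exact_mod_cast relCount_mono Finset.subset_union_left Finset.subset_union_right
  have h4 : (relCount r L K : ℝ) ≤ relCount r L F + relCount r L Y := by
    exact_mod_cast (relCount_le_union_nbrSet r L F K).trans (relCount_union_le _ _ _ _)
  have h5 := le_relCount hd
  have h6 := mul_le_mul_of_nonneg_left hZ hlam
  have h7 : γ * L.card * Y.card ≤ γ * L.card * (κ / 2) := by gcongr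
  nlinarith

/-! ### Joining one pair of vertices. -/

/-- `u` ends a walk of length `j` from `a` with steps prescribed by `rel`, whose vertices after
the first are distinct elements of `F`. -/
def Reach (rel : ℕ → V → V → Prop) (a : V) (F : Finset V) (j : ℕ) (u : V) : Prop :=
  ∃ f : ℕ → V, f 0 = a ∧ f j = u ∧ (∀ i < j, rel i (f i) (f (i + 1))) ∧
    (∀ i ∈ Set.Icc 1 j, f i ∈ F) ∧ Set.InjOn f (Set.Icc 1 j)

theorem Reach.succ {rel : ℕ → V → V → Prop} {a u w : V} {F F' : Finset V} {j : ℕ}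
    (h : Reach rel a F j u) (hF : F ⊆ F') (hw : w ∉ F) (hw' : w ∈ F') (huw : rel j u w) :
    Reach rel a F' (j + 1) w := by
  obtain ⟨f, f0, fj, fr, fF, finj⟩ := h
  have hval : ∀ i, i ≤ j → Function.update f (j + 1) w i = f i := fun i hi =>
    Function.update_of_ne (by omega) _ _
  have hcase : ∀ i ∈ Set.Icc 1 (j + 1), i = j + 1 ∨ i ∈ Set.Icc 1 j := by
    intro i hi
    simp only [Set.mem_Icc] at hi ⊢
    omega
  refine ⟨Function.update f (j + 1) w, ?_, Function.update_self _ _ _, ?_, ?_, ?_⟩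
  · rw [hval 0 (by omega), f0]
  · intro i hi
    rcases Nat.lt_succ_iff_lt_or_eq.1 hi with h | rfl
    · rw [hval i h.le, hval (i + 1) h]
      exact fr i h
    · rw [hval i le_rfl, Function.update_self, fj]
      exact huw
  · intro i hi
    rcases hcase i hi with rfl | h
    · rwa [Function.update_self]
    · rw [hval i h.2]
      exact hF (fF i h)
  · intro i hi i' hi' heq
    rcases hcase i hi with rfl | h <;> rcases hcase i' hi' with rfl | h'
    · rfl
    · rw [Function.update_self, hval i' h'.2] at heq
      exact absurd (heq ▸ fF i' h') hw
    · rw [Function.update_self, hval i h.2] at heq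
      exact absurd (heq ▸ fF i h) hw
    · rw [hval i h.2, hval i' h'.2] at heq
      exact finj h h' heq

theorem Sparse.of_eq_or {r r' : V → V → Prop} {Λ lam T γ : ℝ} (h : Sparse r Λ lam T γ)
    (hr : r' = r ∨ r' = flip r) : Sparse r' Λ lam T γ := by
  rcases hr with rfl | rfl
  · exact h
  · exact h.swap

/-- One expansion step: the ends of the walks in `F` are replaced by twice as many. -/
theorem Sparse.exists_double {r : V → V → Prop} {Λ lam T γ d : ℝ}
    (h : Sparse r Λ lam T γ) (hlam : 0 ≤ lam) (hdl : 15 * lam < d) {K : Finset V}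
    {rel : ℕ → V → V → Prop} {a : V} {F G L : Finset V} {j : ℕ}
    (hrel : rel j = r ∨ rel j = flip r)
    (hdeg : ∀ x, x = a ∨ x ∈ K → d ≤ ((K.filter (rel j x)).card : ℝ))
    (hFK : F ⊆ K) (hFG : Disjoint F G) (hL : L.card = 2 ^ j)
    (hF : F.card ≤ 2 * 2 ^ j) (hG : G.card ≤ 4 * 2 ^ j) (hΛ : 15 * (2 : ℝ) ^ j ≤ Λ)
    (hLF : L ⊆ insert a F) (hreach : ∀ u ∈ L, Reach rel a F j u) :
    ∃ L' F' : Finset V, F' ⊆ K ∧ Disjoint F' G ∧ L'.card = 2 ^ (j + 1) ∧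
      F'.card ≤ 2 * 2 ^ (j + 1) ∧ L' ⊆ F' ∧ ∀ u ∈ L', Reach rel a F' (j + 1) u := by
  have hne : L.Nonempty := Finset.card_pos.1 (by rw [hL]; positivity)
  have h1 := (h.of_eq_or hrel).two_mul_card_lt_nbrSet hlam (L := L) (F := F ∪ G) (K := K) hne
    (fun x hx => hdeg x ((Finset.mem_insert.1 (hLF hx)).imp_right fun h => hFK h))
    (by have := Finset.card_union_le F G; omega) (by rw [hL]; exact_mod_cast hΛ) hdl
  obtain ⟨L', hL'sub, hL'c⟩ := Finset.exists_subset_card_eq h1.le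
  have hmem : ∀ w ∈ L', w ∈ K ∧ w ∉ F ∧ w ∉ G ∧ ∃ u ∈ L, rel j u w := by
    intro w hw
    have := Finset.mem_filter.1 (hL'sub hw)
    simp only [Finset.mem_sdiff, Finset.mem_union, not_or] at this
    exact ⟨this.1.1, this.1.2.1, this.1.2.2, this.2⟩
  refine ⟨L', F ∪ L', Finset.union_subset hFK fun w hw => (hmem w hw).1, ?_, ?_, ?_,
    Finset.subset_union_right, ?_⟩
  · rw [Finset.disjoint_union_left]
    exact ⟨hFG, Finset.disjoint_left.2 fun w hw => (hmem w hw).2.2.1⟩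
  · rw [hL'c, hL]; ring
  · have := Finset.card_union_le F L'
    rw [hL'c, hL] at this
    rw [pow_succ]
    omega
  · intro w hw
    obtain ⟨-, hwF, -, u, hu, huw⟩ := hmem w hw
    exact (hreach u hu).succ Finset.subset_union_left hwF (Finset.mem_union_right _ hw) huw

/-- The two ends are expanded alternately, each avoiding the vertices already used by the other, so
that walks from different ends never meet. The second expansion of a round faces an already doubled
set, hence the bound 4 · 2 ^ j in `Sparse.exists_double`. -/
theorem Sparse.exists_layers {r : V → V → Prop} {Λ lam T γ d : ℝ}
    (h : Sparse r Λ lam T γ) (hlam : 0 ≤ lam) (hdl : 15 * lam < d) {K : Finset V}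
    {rel rel' : ℕ → V → V → Prop} {a b : V}
    (hrel : ∀ j, rel j = r ∨ rel j = flip r) (hrel' : ∀ j, rel' j = r ∨ rel' j = flip r)
    (hdeg : ∀ x j, x = a ∨ x ∈ K → d ≤ ((K.filter (rel j x)).card : ℝ))
    (hdeg' : ∀ x j, x = b ∨ x ∈ K → d ≤ ((K.filter (rel' j x)).card : ℝ))
    (j : ℕ) (hΛ : 15 * (2 : ℝ) ^ j ≤ Λ) :
    ∃ L R F G : Finset V, F ⊆ K ∧ G ⊆ K ∧ Disjoint F G ∧ L.card = 2 ^ j ∧ R.card = 2 ^ j ∧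
      F.card ≤ 2 * 2 ^ j ∧ G.card ≤ 2 * 2 ^ j ∧ L ⊆ insert a F ∧ R ⊆ insert b G ∧
      (∀ u ∈ L, Reach rel a F j u) ∧ (∀ u ∈ R, Reach rel' b G j u) := by
  induction j with
  | zero =>
    refine ⟨{a}, {b}, ∅, ∅, by simp, by simp, by simp, by simp, by simp, by simp, by simp,
      by simp, by simp, ?_, ?_⟩
    · intro u hu
      exact ⟨fun _ => a, rfl, (Finset.mem_singleton.1 hu).symm, by simp,
        fun i hi => by simp at hi, fun i hi => by simp at hi⟩
    · intro u hu
      exact ⟨fun _ => b, rfl, (Finset.mem_singleton.1 hu).symm, by simp,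
        fun i hi => by simp at hi, fun i hi => by simp at hi⟩
  | succ j ih =>
    have hΛ' : 15 * (2 : ℝ) ^ j ≤ Λ := by
      refine le_trans ?_ hΛ
      rw [pow_succ]
      nlinarith [pow_pos (two_pos : (0 : ℝ) < 2) j]
    obtain ⟨L, R, F, G, hF, hG, hFG, hL, hR, hFc, hGc, hLF, hRG, hLr, hRr⟩ := ih hΛ'
    obtain ⟨L', F', a1, a2, a3, a4, a5, a6⟩ := h.exists_double hlam hdl (hrel j)
      (fun x => hdeg x j) hF hFG hL hFc (hGc.trans (by omega)) hΛ' hLF hLr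
    obtain ⟨R', G', b1, b2, b3, b4, b5, b6⟩ := h.exists_double hlam hdl (hrel' j)
      (fun x => hdeg' x j) hG a2.symm hR hGc (a4.trans (by rw [pow_succ]; omega)) hΛ' hRG hRr
    exact ⟨L', R', F', G', a1, b1, b2.symm, a3, b3, a4, b4,
      a5.trans (Finset.subset_insert _ _), b5.trans (Finset.subset_insert _ _), a6, b6⟩

/-- In a set with large minimum semidegree, two outside vertices are joined by a path of a
prescribed length whose arcs have prescribed orientations. -/
theorem Sparse.exists_path {r : V → V → Prop} {Λ lam T γ d κ : ℝ}
    (h : Sparse r Λ lam T γ) (hlam : 0 ≤ lam) (hγ : 0 ≤ γ) (hdl : 15 * lam < d)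
    (hdκ : 13 * lam + γ * κ / 2 < d) {K : Finset V} (hK : (K.card : ℝ) ≤ κ)
    {rel : ℕ → V → V → Prop} {a b : V} (hb : b ∉ K)
    (hrel : ∀ j, rel j = r ∨ rel j = flip r)
    (hdeg : ∀ x, x = a ∨ x = b ∨ x ∈ K → d ≤ ((K.filter (r x)).card : ℝ) ∧
      d ≤ ((K.filter (flip r x)).card : ℝ))
    (J : ℕ) (hJT : T ≤ 2 ^ J) (hΛ : 30 * (2 : ℝ) ^ J ≤ Λ) :
    ∃ g : ℕ → V, g 0 = a ∧ g (2 * J + 3) = b ∧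
      (∀ i < 2 * J + 3, rel i (g i) (g (i + 1))) ∧
      (∀ i ∈ Set.Icc 1 (2 * J + 2), g i ∈ K) ∧ Set.InjOn g (Set.Icc 1 (2 * J + 2)) := by
  have h2J : (0 : ℝ) < 2 ^ J := by positivity
  -- Walks from b traverse the path backwards: step j is the reversed arc 2J + 2 - j, the last arc
  -- having index 2J + 2.
  set rel' : ℕ → V → V → Prop := fun j => flip (rel (2 * J + 2 - j)) with hrel'def
  have hrel' : ∀ j, rel' j = r ∨ rel' j = flip r := by
    intro j
    rcases hrel (2 * J + 2 - j) with h1 | h1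
    · right; simp only [hrel'def, h1]
    · left; simp only [hrel'def, h1]; rfl
  have hdeg1 : ∀ x j, x = a ∨ x ∈ K → d ≤ ((K.filter (rel j x)).card : ℝ) := by
    intro x j hx
    have := hdeg x (by tauto)
    rcases hrel j with h1 | h1
    · rw [h1]; exact this.1
    · rw [h1]; exact this.2
  have hdeg2 : ∀ x j, x = b ∨ x ∈ K → d ≤ ((K.filter (rel' j x)).card : ℝ) := by
    intro x j hx
    have := hdeg x (by tauto)
    rcases hrel' j with h1 | h1
    · rw [h1]; exact this.1
    · rw [h1]; exact this.2
  obtain ⟨L, R, F, G, hF, hG, hFG, hL, hR, hFc, hGc, hLF, hRG, hLr, hRr⟩ :=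
    h.exists_layers hlam hdl hrel hrel' hdeg1 hdeg2 J (by linarith)
  -- One extra doubling on the side of a gives length (J + 1) + 1 + 1 + J, hence an even number 2J +
  -- 2 of inner vertices, as the alternating cycles need.
  obtain ⟨L', F', a1, a2, a3, a4, a5, a6⟩ := h.exists_double hlam hdl (hrel J)
      (fun x => hdeg1 x J) hF hFG hL hFc (hGc.trans (by omega)) (by linarith) hLF hLr
  have hFGc : (F' ∪ G).card ≤ 6 * 2 ^ J := by
    have := Finset.card_union_le F' G
    rw [pow_succ] at a4
    omega
  have hL'c : (L'.card : ℝ) = 2 * 2 ^ J := by rw [a3, pow_succ]; push_cast; ring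
  have hRc : (R.card : ℝ) = 2 ^ J := by rw [hR]; push_cast; ring
  have y1 := (h.of_eq_or (hrel (J + 1))).half_lt_card_nbrSet hlam hγ (L := L') (F := F' ∪ G)
    (K := K) (κ := κ) (Finset.card_pos.1 (by rw [a3]; positivity))
    (fun x hx => hdeg1 x _ (Or.inr (a1 (a5 hx))))
    (by rw [a3, pow_succ]; omega) (by linarith) hdl (by linarith)
    (Finset.disjoint_left.2 fun x hx hx' =>
      (Finset.mem_sdiff.1 hx').2 (Finset.mem_union_left _ (a5 hx))) hdκ
  have y2 := (h.of_eq_or (hrel' J)).half_lt_card_nbrSet hlam hγ (L := R) (F := F' ∪ G)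
    (K := K) (κ := κ) (Finset.card_pos.1 (by rw [hR]; positivity))
    (fun x hx => hdeg2 x _ ((Finset.mem_insert.1 (hRG hx)).imp_right fun h => hG h))
    (by rw [hR]; omega) (by linarith) hdl (by linarith)
    (Finset.disjoint_left.2 fun x hx hx' => by
      rcases Finset.mem_insert.1 (hRG hx) with rfl | h'
      · exact hb (Finset.mem_sdiff.1 hx').1
      · exact (Finset.mem_sdiff.1 hx').2 (Finset.mem_union_right _ h')) hdκ
  -- Two subsets of K, each larger than κ/2 ≥ |K|/2, intersect.
  obtain ⟨w, hw1, hw2⟩ : ∃ w, w ∈ nbrSet (rel (J + 1)) L' (K \ (F' ∪ G)) ∧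
      w ∈ nbrSet (rel' J) R (K \ (F' ∪ G)) := by
    by_contra! hcon
    have hd : Disjoint (nbrSet (rel (J + 1)) L' (K \ (F' ∪ G)))
      (nbrSet (rel' J) R (K \ (F' ∪ G))) := Finset.disjoint_left.2 hcon
    have hsub := Finset.card_le_card (Finset.union_subset
      (nbrSet_subset (rel (J + 1)) L' (K \ (F' ∪ G))) (nbrSet_subset (rel' J) R (K \ (F' ∪ G))))
    rw [Finset.card_union_of_disjoint hd] at hsub
    have hsub' := hsub.trans (Finset.card_le_card Finset.sdiff_subset)
    have : ((nbrSet (rel (J + 1)) L' (K \ (F' ∪ G))).card : ℝ) +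
      (nbrSet (rel' J) R (K \ (F' ∪ G))).card ≤ K.card := by exact_mod_cast hsub'
    linarith
  obtain ⟨hwK, u, hu, huw⟩ := Finset.mem_filter.1 hw1
  obtain ⟨-, u', hu', huw'⟩ := Finset.mem_filter.1 hw2
  simp only [Finset.mem_sdiff, Finset.mem_union, not_or] at hwK
  obtain ⟨f, f0, fj, fr, fF, finj⟩ := a6 u hu
  obtain ⟨f', f0', fj', fr', fF', finj'⟩ := hRr u' hu'
  set g : ℕ → V := fun i => if i ≤ J + 1 then f i else if i = J + 2 then w else f' (2 * J + 3 - i)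
    with hg
  have g1 : ∀ i, i ≤ J + 1 → g i = f i := fun i hi => by simp only [hg, if_pos hi]
  have g2 : g (J + 2) = w := by simp [hg]
  have g3 : ∀ i, J + 3 ≤ i → g i = f' (2 * J + 3 - i) := fun i hi => by
    simp only [hg]; rw [if_neg (by omega), if_neg (by omega)]
  have hcase : ∀ i ∈ Set.Icc 1 (2 * J + 2), (i ∈ Set.Icc 1 (J + 1) ∧ g i = f i ∧ g i ∈ F') ∨
      (i = J + 2 ∧ g i = w) ∨ (2 * J + 3 - i ∈ Set.Icc 1 J ∧ g i = f' (2 * J + 3 - i) ∧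
        g i ∈ G) := by
    intro i hi
    simp only [Set.mem_Icc] at hi
    rcases le_or_gt i (J + 1) with h1 | h1
    · left
      exact ⟨⟨hi.1, h1⟩, g1 i h1, by rw [g1 i h1]; exact fF i ⟨hi.1, h1⟩⟩
    · right
      rcases Nat.eq_or_lt_of_le (show J + 2 ≤ i from h1) with h2 | h2
      · left
        exact ⟨h2.symm, by rw [← h2, g2]⟩
      · right
        have h3 : 2 * J + 3 - i ∈ Set.Icc 1 J := by simp only [Set.mem_Icc]; omega
        exact ⟨h3, g3 i h2, by rw [g3 i h2]; exact fF' _ h3⟩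
  refine ⟨g, by rw [g1 0 (by omega), f0], by rw [g3 _ (by omega)]; simpa using f0', ?_, ?_, ?_⟩
  · intro i hi
    rcases lt_trichotomy i (J + 1) with h1 | h1 | h1
    · rw [g1 i h1.le, g1 (i + 1) h1]
      exact fr i h1
    · subst h1
      rw [g1 _ le_rfl, g2, fj]
      exact huw
    · rcases Nat.eq_or_lt_of_le (show J + 2 ≤ i from h1) with h2 | h2
      · subst h2
        rw [g2, g3 _ le_rfl, show 2 * J + 3 - (J + 2 + 1) = J by omega, fj']
        have := huw'
        simp only [hrel'def, flip] at this
        rwa [show 2 * J + 2 - J = J + 2 by omega] at this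
      · rw [g3 i h2, g3 (i + 1) (by omega)]
        have := fr' (2 * J + 3 - (i + 1)) (by omega)
        simp only [hrel'def, flip] at this
        rwa [show 2 * J + 2 - (2 * J + 3 - (i + 1)) = i by omega,
          show 2 * J + 3 - (i + 1) + 1 = 2 * J + 3 - i by omega] at this
  · intro i hi
    rcases hcase i hi with ⟨-, -, h1⟩ | ⟨-, h1⟩ | ⟨-, -, h1⟩
    · exact a1 h1
    · rw [h1]; exact hwK.1
    · exact hG h1
  · intro i hi i' hi' heq
    rcases hcase i hi with ⟨h0, h1, h2⟩ | ⟨h0, h1⟩ | ⟨h0, h1, h2⟩ <;>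
      rcases hcase i' hi' with ⟨h0', h1', h2'⟩ | ⟨h0', h1'⟩ | ⟨h0', h1', h2'⟩
    · exact finj h0 h0' (by rw [← h1, ← h1', heq])
    · exact absurd (by rwa [heq, h1'] at h2) hwK.2.1
    · exact absurd (heq ▸ h2') (Finset.disjoint_left.1 a2 h2)
    · exact absurd (by rwa [← heq, h1] at h2') hwK.2.1
    · omega
    · exact absurd (by rwa [← heq, h1] at h2') hwK.2.2
    · exact absurd (heq ▸ h2) (Finset.disjoint_left.1 a2 h2')
    · exact absurd (by rwa [heq, h1'] at h2) hwK.2.2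
    · have := finj' h0 h0' (by rw [← h1, ← h1', heq])
      simp only [Set.mem_Icc] at hi hi'
      omega

/-! ### Joining many pairs simultaneously. -/

/-- The connecting lemma: many pairs of vertices are joined simultaneously through `K` by
disjoint paths of a prescribed length with prescribed orientations of the arcs. -/
theorem Sparse.exists_disjoint_paths [Fintype V] {r : V → V → Prop} {Λ lam T γ d b q κ : ℝ}
    (h : Sparse r Λ lam T γ) (hT : 1 ≤ T) (hlam : 0 ≤ lam) (hγ : 0 ≤ γ)
    {ι : Type*} (S : Finset ι) (J : ℕ) (hJT : T ≤ 2 ^ J) (hΛ : 30 * (2 : ℝ) ^ J ≤ Λ)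
    {u C : ℝ} (hC : C = 8 * J + 8) (hS : (4 * J + 4) * (S.card : ℝ) ≤ u)
    (hu : u + 2 * T ≤ Fintype.card V)
    (hb1 : lam + γ * u ≤ b) (hb3 : lam * (1 + C) ≤ b)
    (hb4 : lam + 2 * γ * T * C ≤ b) (hq : 2 * b < q)
    (hdl : 15 * lam < d) (hdκ : 13 * lam + γ * κ / 2 < d)
    {K : Finset V} (hK : (K.card : ℝ) ≤ κ)
    (hdeg : ∀ x, d + q ≤ ((K.filter (r x)).card : ℝ) ∧ d + q ≤ ((K.filter (flip r x)).card : ℝ))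
    {rel : ℕ → V → V → Prop} (hrel : ∀ j, rel j = r ∨ rel j = flip r)
    {s t : ι → V} (hs : Set.InjOn s S) (ht : Set.InjOn t S)
    (hsK : ∀ i ∈ S, s i ∉ K) (htK : ∀ i ∈ S, t i ∉ K) :
    ∃ g : ι → ℕ → V, ∀ i ∈ S, g i 0 = s i ∧ g i (2 * J + 3) = t i ∧
      (∀ m < 2 * J + 3, rel m (g i m) (g i (m + 1))) ∧
      (∀ m ∈ Set.Icc 1 (2 * J + 2), g i m ∈ K) ∧
      ∀ j ∈ S, ∀ m ∈ Set.Icc 1 (2 * J + 2), ∀ m' ∈ Set.Icc 1 (2 * J + 2),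
        g i m = g j m' → i = j ∧ m = m' := by
  have hJ0 : (0 : ℝ) ≤ J := by positivity
  set Path : ι → (ℕ → V) → Prop := fun i g => g 0 = s i ∧ g (2 * J + 3) = t i ∧
      (∀ m < 2 * J + 3, rel m (g m) (g (m + 1))) ∧
      (∀ m ∈ Set.Icc 1 (2 * J + 2), g m ∈ K) ∧ Set.InjOn g (Set.Icc 1 (2 * J + 2)) with hPath
  set E : ι → Set (Finset V) := fun i =>
    {e | ∃ g, Path i g ∧ e = (Finset.Icc 1 (2 * J + 2)).image g} with hE
  obtain ⟨M, hM, hMd⟩ := exists_disjoint_choice E (2 * J + 2) (by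
      rintro i e ⟨g, -, rfl⟩
      exact Finset.card_image_le.trans (by simp)) S (by
    intro I hIS hI U hU
    have hIpos := hI.card_pos
    -- Only vertices of K can block, and discarding the others ensures that U₀ contains no end
    -- vertex.
    set U₀ := U ∩ K with hU₀
    have hU₀c : (U₀.card : ℝ) ≤ (4 * J + 4) * I.card := by
      have : U₀.card ≤ 2 * (2 * J + 2) * I.card :=
        (Finset.card_le_card Finset.inter_subset_left).trans hU
      have h' : (U₀.card : ℝ) ≤ 2 * (2 * J + 2) * I.card := by exact_mod_cast this
      linarith
    -- With this rounding, |U₀| ≤ (8J + 8)s₀, and |X| < s₀ gives 2|X| < |I|. As s and t are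
    -- injective, X cannot contain an end of every pair.
    set s₀ := (I.card + 1) / 2 with hs₀
    have hIs₀ : (I.card : ℝ) ≤ 2 * s₀ := by
      have : I.card ≤ 2 * s₀ := by omega
      exact_mod_cast this
    obtain ⟨X, hXd, hXc, hX⟩ := h.exists_closure (U := U₀) (s := s₀) (C := C) (u := u) hT
      (by linarith) hlam hγ hu hb1 (by nlinarith) hb3 hb4 hq (by omega)
      (hU₀c.trans (le_trans (by
        have : (I.card : ℝ) ≤ S.card := by exact_mod_cast Finset.card_le_card hIS
        gcongr) hS))
      (hU₀c.trans (by
        rw [hC]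
        have := mul_le_mul_of_nonneg_left hIs₀ (by positivity : (0 : ℝ) ≤ 4 * J + 4)
        linarith))
    obtain ⟨i, hiI, his, hit⟩ : ∃ i ∈ I, s i ∉ X ∧ t i ∉ X := by
      by_contra! hcon
      have hsub : I ⊆ I.filter (fun i => s i ∈ X) ∪ I.filter (fun i => t i ∈ X) := by
        intro i hi
        by_cases h1 : s i ∈ X
        · exact Finset.mem_union_left _ (Finset.mem_filter.2 ⟨hi, h1⟩)
        · exact Finset.mem_union_right _ (Finset.mem_filter.2 ⟨hi, hcon i hi h1⟩)
      have hbd : ∀ f : ι → V, Set.InjOn f S → (I.filter (fun i => f i ∈ X)).card ≤ X.card := by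
        intro f hf
        refine Finset.card_le_card_of_injOn f (fun i hi => (Finset.mem_filter.1 hi).2) ?_
        exact hf.mono fun i hi => hIS (Finset.mem_filter.1 hi).1
      have e1 := Finset.card_le_card hsub
      have e2 := Finset.card_union_le (I.filter (fun i => s i ∈ X)) (I.filter (fun i => t i ∈ X))
      have e3 := hbd s hs
      have e4 := hbd t ht
      omega
    have hsK' := hsK i (hIS hiI)
    have htK' := htK i (hIS hiI)
    have hdeg' : ∀ x, x ∉ U₀ ∪ X → d ≤ (((K \ (U₀ ∪ X)).filter (r x)).card : ℝ) ∧
        d ≤ (((K \ (U₀ ∪ X)).filter (flip r x)).card : ℝ) := by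
      intro x hx
      have key : ∀ r' : V → V → Prop, d + q ≤ ((K.filter (r' x)).card : ℝ) →
          (((U₀ ∪ X).filter (r' x)).card : ℝ) ≤ q →
          d ≤ (((K \ (U₀ ∪ X)).filter (r' x)).card : ℝ) := by
        intro r' h1 h2
        have hsub : K.filter (r' x) ⊆
            (K \ (U₀ ∪ X)).filter (r' x) ∪ (U₀ ∪ X).filter (r' x) := by
          intro y hy
          rw [Finset.mem_filter] at hy
          rw [← Finset.filter_union, Finset.mem_filter, Finset.sdiff_union_self_eq_union]
          exact ⟨Finset.mem_union_left _ hy.1, hy.2⟩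
        have h3 := (Finset.card_le_card hsub).trans (Finset.card_union_le _ _)
        have h4 : ((K.filter (r' x)).card : ℝ) ≤ (((K \ (U₀ ∪ X)).filter (r' x)).card : ℝ) +
          (((U₀ ∪ X).filter (r' x)).card : ℝ) := by exact_mod_cast h3
        linarith
      exact ⟨key r (hdeg x).1 (hX x hx).1, key (flip r) (hdeg x).2 (hX x hx).2⟩
    obtain ⟨g, g0, gN, gr, gK, ginj⟩ := h.exists_path (K := K \ (U₀ ∪ X)) (a := s i) (b := t i)
      (κ := κ) hlam hγ hdl hdκ
      (le_trans (by exact_mod_cast Finset.card_le_card Finset.sdiff_subset) hK)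
      (fun h' => htK' (Finset.mem_sdiff.1 h').1) hrel
      (by
        rintro x (rfl | rfl | hx)
        · refine hdeg' _ ?_
          rw [Finset.mem_union, not_or]
          exact ⟨fun h' => hsK' (Finset.mem_inter.1 h').2, his⟩
        · refine hdeg' _ ?_
          rw [Finset.mem_union, not_or]
          exact ⟨fun h' => htK' (Finset.mem_inter.1 h').2, hit⟩
        · exact hdeg' x (Finset.mem_sdiff.1 hx).2) J hJT hΛ
    refine ⟨i, hiI, _, ⟨g, ⟨g0, gN, gr, fun m hm => (Finset.mem_sdiff.1 (gK m hm)).1, ginj⟩,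
      rfl⟩, ?_⟩
    rw [Finset.disjoint_left]
    intro y hy hyU
    obtain ⟨m, hm, rfl⟩ := Finset.mem_image.1 hy
    have := Finset.mem_sdiff.1 (gK m (by simpa using hm))
    exact this.2 (Finset.mem_union_left _ (Finset.mem_inter.2 ⟨hyU, this.1⟩)))
  rcases isEmpty_or_nonempty V with hV | hV
  · exact ⟨fun i => isEmptyElim (s i), fun i => isEmptyElim (s i)⟩
  choose! g hg hgM using hM
  refine ⟨g, fun i hi => ?_⟩
  obtain ⟨g0, gN, gr, gK, ginj⟩ := hg i hi
  refine ⟨g0, gN, gr, gK, fun j hj m hm m' hm' heq => ?_⟩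
  by_cases hij : i = j
  · subst hij
    exact ⟨rfl, ginj hm hm' heq⟩
  · exfalso
    have hd := hMd i hi j hj hij
    rw [hgM i hi, hgM j hj, Finset.disjoint_left] at hd
    exact hd (Finset.mem_image_of_mem _ (by simpa using hm))
      (by rw [heq]; exact Finset.mem_image_of_mem _ (by simpa using hm'))

/-! ### Walks as lists and the switching of absorbers. -/

/-- The list `a :: l` is a walk along `R` that ends in `b`. -/
def IsWalk (R : V → V → Prop) (a : V) (l : List V) (b : V) : Prop :=
  List.IsChain R (a :: l) ∧ (a :: l).getLast? = some b

theorem IsWalk.nil (R : V → V → Prop) (a : V) : IsWalk R a [] a := by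
  simp [IsWalk]

theorem IsWalk.cons {R : V → V → Prop} {a b c : V} {l : List V} (hab : R a b)
    (h : IsWalk R b l c) : IsWalk R a (b :: l) c :=
  ⟨List.isChain_cons_cons.2 ⟨hab, h.1⟩, by rw [List.getLast?_cons_cons]; exact h.2⟩

theorem IsWalk.append {R : V → V → Prop} {a b c : V} {l l' : List V} (h : IsWalk R a l b)
    (h' : IsWalk R b l' c) : IsWalk R a (l ++ l') c := by
  induction l generalizing a with
  | nil =>
    have : a = b := by simpa [IsWalk] using h.2
    subst this
    exact h'
  | cons d l ih =>
    have h1 := List.isChain_cons_cons.1 h.1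
    have h2 := h.2
    rw [List.getLast?_cons_cons] at h2
    exact (ih ⟨h1.2, h2⟩).cons h1.1

theorem IsWalk.flatMap {R : V → V → Prop} {w : ℕ → V} {B : ℕ → List V} (n : ℕ)
    (h : ∀ i < n, IsWalk R (w i) (B i) (w (i + 1))) :
    IsWalk R (w 0) ((List.range n).flatMap B) (w n) := by
  induction n with
  | zero => exact IsWalk.nil R _
  | succ n ih =>
    rw [List.range_succ, List.flatMap_append, List.flatMap_singleton]
    exact (ih fun i hi => h i (by omega)).append (h n (by omega))

theorem coe_flatMap_range (B : ℕ → List V) (n : ℕ) :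
    (((List.range n).flatMap B : List V) : Multiset V) =
      ∑ i ∈ Finset.range n, (B i : Multiset V) := by
  induction n with
  | zero => rfl
  | succ n ih =>
    rw [List.range_succ, List.flatMap_append, List.flatMap_singleton, ← Multiset.coe_add, ih,
      Finset.sum_range_succ]

theorem flatMap_range_mul (B : ℕ → List V) (m k : ℕ) :
    (List.range (m * k)).flatMap B =
      (List.range m).flatMap (fun c => (List.range k).flatMap (fun i => B (c * k + i))) := by
  induction m with
  | zero => simp
  | succ m ih =>
    rw [List.range_succ, List.flatMap_append, List.flatMap_singleton, ← ih, Nat.succ_mul,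
      List.range_add, List.flatMap_append, List.flatMap_map]

/-- The blocks `B 0, …, B (2h)` in the order that makes room for `x`. -/
def absorbingOrder (B : ℕ → List V) (h : ℕ) (x : V) : List V :=
  (List.range h).flatMap (fun i => B (2 * i + 1)) ++
    x :: (List.range (h + 1)).flatMap (fun i => B (2 * i))

theorem absorbingOrder_perm (B : ℕ → List V) (h : ℕ) (x : V) :
    (absorbingOrder B h x).Perm (x :: (List.range (2 * h + 1)).flatMap B) := by
  rw [← Multiset.coe_eq_coe, absorbingOrder, ← Multiset.coe_add, ← Multiset.cons_coe,
    ← Multiset.cons_coe, coe_flatMap_range, coe_flatMap_range, coe_flatMap_range,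
    Multiset.add_cons]
  congr 1
  induction h with
  | zero => simp
  | succ h ih =>
    rw [Finset.sum_range_succ (fun i => (B (2 * i + 1) : Multiset V)) h,
      Finset.sum_range_succ (fun i => (B (2 * i) : Multiset V)) (h + 1),
      show 2 * (h + 1) + 1 = 2 * h + 1 + 1 + 1 by ring,
      Finset.sum_range_succ (fun i => (B i : Multiset V)) (2 * h + 1 + 1),
      Finset.sum_range_succ (fun i => (B i : Multiset V)) (2 * h + 1), ← ih,
      show 2 * (h + 1) = 2 * h + 1 + 1 by ring]
    abel

/-- From vertices `x c`, alternating cycles through them and paths linking consecutive vertices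
of these cycles one obtains a path that can absorb every set of vertices `x c`. -/
theorem exists_absorption (D : Digraph V) (m h : ℕ) (x y z : ℕ → V) (seg : ℕ → List V)
    (hzy : ∀ i < m * (2 * h + 1), D.Adj (z i) (y i))
    (hzy' : ∀ c < m, ∀ i < 2 * h,
      D.Adj (z (c * (2 * h + 1) + i)) (y (c * (2 * h + 1) + i + 1)))
    (hxy : ∀ c < m, D.Adj (x c) (y (c * (2 * h + 1))))
    (hzx : ∀ c < m, D.Adj (z (c * (2 * h + 1) + 2 * h)) (x c))
    (hseg : ∀ i < m * (2 * h + 1), IsWalk D.Adj (y i) (seg i ++ [z (i + 1)]) (z (i + 1)))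
    (hinj : Set.InjOn x (Set.Iio m)) {l : List V}
    (hl : l = z 0 :: (List.range (m * (2 * h + 1))).flatMap
      (fun i => y i :: (seg i ++ [z (i + 1)])))
    (hnodup : l.Nodup) (hxl : ∀ c < m, x c ∉ l) :
    IsDirectedPath D l ∧ ∀ W : Finset V, (∀ v ∈ W, ∃ c < m, x c = v) →
      ∃ l' : List V, IsDirectedPath D l' ∧ (∀ v, v ∈ l' ↔ v ∈ l ∨ v ∈ W) ∧
        SameEndpoints l' l := by
  set k := 2 * h + 1 with hk
  set B : ℕ → List V := fun i => y i :: (seg i ++ [z (i + 1)]) with hB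
  have hwalk : IsWalk D.Adj (z 0) ((List.range (m * k)).flatMap B) (z (m * k)) :=
    IsWalk.flatMap _ fun i hi => (hseg i hi).cons (hzy i hi)
  refine ⟨⟨by rw [hl]; simp, hnodup, by rw [hl]; exact hwalk.1⟩, fun W hW => ?_⟩
  have hck : ∀ c < m, ∀ i < k, c * k + i < m * k := fun c hc i hi => by
    calc c * k + i < c * k + k := by omega
      _ = (c + 1) * k := by ring
      _ ≤ m * k := Nat.mul_le_mul_right k hc
  set T : ℕ → List V := fun c => if x c ∈ W then absorbingOrder (fun i => B (c * k + i)) h (x c)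
    else (List.range k).flatMap (fun i => B (c * k + i)) with hT
  set l' := z 0 :: (List.range m).flatMap T with hl'
  have hwalk' : IsWalk D.Adj (z 0) ((List.range m).flatMap T) (z (m * k)) := by
    have := IsWalk.flatMap (R := D.Adj) (w := fun c => z (c * k)) (B := T) m ?_
    · simpa using this
    intro c hc
    simp only [hT]
    have hend : c * k + (2 * h + 1) = (c + 1) * k := by rw [hk]; ring
    split_ifs with hcW
    -- The odd blocks lead from the first z of the cycle, by steps of two, to the one with index 2h,
    -- which precedes x c. This needs the number k = 2h + 1 of blocks to be odd.
    · have h1 := IsWalk.flatMap (R := D.Adj) (w := fun i => z (c * k + 2 * i))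
        (B := fun i => B (c * k + (2 * i + 1))) h (fun i hi => by
          have := (hseg (c * k + (2 * i + 1)) (hck c hc _ (by omega))).cons
            (hzy' c hc (2 * i) (by omega))
          rwa [show c * k + (2 * i + 1) + 1 = c * k + 2 * (i + 1) by ring] at this)
      -- Entry points of the even blocks: first x c, then the z of odd index. The last even block
      -- ends at the first z of the next cycle.
      obtain ⟨w, w0, ws⟩ : ∃ w : ℕ → V, w 0 = x c ∧ ∀ i, w (i + 1) = z (c * k + (2 * i + 1)) :=
        ⟨fun i => if i = 0 then x c else z (c * k + (2 * i - 1)), rfl, fun i => rfl⟩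
      have h2 := IsWalk.flatMap (R := D.Adj) (w := w) (B := fun i => B (c * k + 2 * i)) (h + 1) (fun i hi => by
          have h3 := hseg (c * k + 2 * i) (hck c hc _ (by omega))
          rw [ws]
          refine h3.cons ?_
          cases i with
          | zero =>
            rw [w0]
            exact hxy c hc
          | succ i =>
            rw [ws]
            exact hzy' c hc (2 * i + 1) (by omega))
      rw [w0, ws, hend] at h2
      exact h1.append (h2.cons (hzx c hc))
    · have h1 := IsWalk.flatMap (R := D.Adj) (w := fun i => z (c * k + i))
        (B := fun i => B (c * k + i)) k (fun i hi =>
          (hseg _ (hck c hc i hi)).cons (hzy _ (hck c hc i hi)))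
      rw [show c * k + k = (c + 1) * k by ring] at h1
      exact h1
  -- This permutation yields the vertex set of the new path and the distinctness of its vertices at
  -- once.
  have hperm : l'.Perm (((List.range m).map x).filter (· ∈ W) ++ l) := by
    rw [hl', hl, flatMap_range_mul]
    refine List.Perm.trans ?_ List.perm_middle.symm
    refine List.Perm.cons _ ?_
    clear_value T
    rw [← Multiset.coe_eq_coe, ← Multiset.coe_add, coe_flatMap_range, coe_flatMap_range]
    clear hwalk hwalk' hck hl hseg hzy hzy' hxy hzx hinj hxl hl' hW
    induction m with
    | zero => simp
    | succ m ih =>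
      rw [Finset.sum_range_succ, Finset.sum_range_succ, ih,
        List.range_succ (n := m), List.map_append, List.filter_append, ← Multiset.coe_add]
      have : (T m : Multiset V) = ((List.map x [m]).filter (· ∈ W) : List V) +
          (((List.range k).flatMap (fun i => B (m * k + i)) : List V) : Multiset V) := by
        rw [hT]
        by_cases hm : x m ∈ W
        · rw [Multiset.coe_add, Multiset.coe_eq_coe]
          simpa [hm] using absorbingOrder_perm (fun i => B (m * k + i)) h (x m)
        · simp [hm]
      rw [this]
      abel
  have hmem : ∀ v, v ∈ l' ↔ v ∈ l ∨ v ∈ W := by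
    intro v
    rw [hperm.mem_iff, List.mem_append, or_comm]
    refine or_congr Iff.rfl ?_
    simp only [List.mem_filter, List.mem_map, List.mem_range, decide_eq_true_eq]
    exact ⟨fun h => h.2, fun h => ⟨hW v h, h⟩⟩
  refine ⟨l', ⟨by simp [hl'], ?_, hwalk'.1⟩, hmem, ?_, ?_⟩
  · rw [hperm.nodup_iff, List.nodup_append]
    refine ⟨List.Nodup.filter _ ?_, hnodup, ?_⟩
    · rw [List.nodup_map_iff_inj_on List.nodup_range]
      intro a ha b hb hab
      exact hinj (List.mem_range.1 ha) (List.mem_range.1 hb) hab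
    · intro a ha b hb hab
      obtain ⟨c, hc, rfl⟩ := List.mem_map.1 (List.mem_filter.1 ha).1
      exact hxl c (List.mem_range.1 hc) (hab ▸ hb)
  · rw [hl', hl]; rfl
  · rw [hl', hl, hwalk'.2, hwalk.2]

/-! ### Building the absorbing path from two connecting sets. -/

/-- Up to `N` pairs of vertices outside `K` can be joined through `K` by disjoint paths with
`2 J + 2` inner vertices and arbitrarily prescribed orientations of the arcs. -/
def Connects (D : Digraph V) (K : Finset V) (N J : ℕ) : Prop :=
  ∀ S : Finset ℕ, S.card ≤ N → ∀ rel : ℕ → V → V → Prop,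
    (∀ j, rel j = D.Adj ∨ rel j = flip D.Adj) → ∀ s t : ℕ → V, Set.InjOn s S → Set.InjOn t S →
    (∀ i ∈ S, s i ∉ K) → (∀ i ∈ S, t i ∉ K) →
    ∃ g : ℕ → ℕ → V, ∀ i ∈ S, g i 0 = s i ∧ g i (2 * J + 3) = t i ∧
      (∀ m < 2 * J + 3, rel m (g i m) (g i (m + 1))) ∧
      (∀ m ∈ Set.Icc 1 (2 * J + 2), g i m ∈ K) ∧
      ∀ j ∈ S, ∀ m ∈ Set.Icc 1 (2 * J + 2), ∀ m' ∈ Set.Icc 1 (2 * J + 2),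
        g i m = g j m' → i = j ∧ m = m'

theorem IsWalk.map_range {R : V → V → Prop} {f : ℕ → V} (n : ℕ)
    (h : ∀ i < n, R (f i) (f (i + 1))) :
    IsWalk R (f 0) ((List.range n).map (fun i => f (i + 1))) (f n) := by
  induction n with
  | zero => exact IsWalk.nil R _
  | succ n ih =>
    rw [List.range_succ, List.map_append, List.map_singleton]
    exact (ih fun i hi => h i (by omega)).append ((IsWalk.nil R _).cons (h n (by omega)))

theorem Finset.exists_enumeration (A : Finset V) (w : V) :
    ∃ x : ℕ → V, Set.InjOn x (Set.Iio A.card) ∧ ∀ v, v ∈ A ↔ ∃ c < A.card, x c = v := by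
  refine ⟨fun c => if hc : c < A.card then (A.equivFin.symm ⟨c, hc⟩ : V) else w, ?_, ?_⟩
  · intro c hc c' hc' heq
    simp only [Set.mem_Iio] at hc hc'
    simp only [hc, hc', dif_pos] at heq
    simpa using A.equivFin.symm.injective (Subtype.ext heq)
  · intro v
    constructor
    · intro hv
      exact ⟨A.equivFin ⟨v, hv⟩, (A.equivFin ⟨v, hv⟩).2, by simp⟩
    · rintro ⟨c, hc, rfl⟩
      simp only [hc, dif_pos]
      exact (A.equivFin.symm ⟨c, hc⟩).2

/-- K₁ carries the alternating cycles through the vertices of A, K₂ the paths linking their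
vertices, and w ends the whole path. -/
theorem Connects.exists_absorbing_path (D : Digraph V) {A K₁ K₂ : Finset V} {w : V} {h : ℕ}
    (h₁ : Connects D K₁ (A.card * (2 * h + 1)) (2 * h))
    (h₂ : Connects D K₂ (A.card * (2 * h + 1)) (2 * h))
    (hA1 : Disjoint A K₁) (hA2 : Disjoint A K₂) (h12 : Disjoint K₁ K₂)
    (hwA : w ∉ A) (hw1 : w ∉ K₁) (hw2 : w ∉ K₂) :
    ∃ l : List V, IsDirectedPath D l ∧ (∀ v ∈ l, v ∈ K₁ ∨ v ∈ K₂ ∨ v = w) ∧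
      ∀ W : Finset V, W ⊆ A → ∃ l' : List V, IsDirectedPath D l' ∧
        (∀ v, v ∈ l' ↔ v ∈ l ∨ v ∈ W) ∧ SameEndpoints l' l := by
  obtain ⟨x, hxinj, hxA⟩ := Finset.exists_enumeration A w
  set m := A.card
  set k := 2 * h + 1 with hk
  set N := m * k with hN
  have hkpos : 0 < k := by omega
  -- Both ends are x, so each path closes to a cycle. Even arcs point forward and odd ones backward;
  -- the last index 4h + 2 is even, so the final arc enters x.
  obtain ⟨G, hG⟩ := h₁ (Finset.range m)
    (by rw [Finset.card_range]; exact Nat.le_mul_of_pos_right _ hkpos)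
    (fun j => if Even j then D.Adj else flip D.Adj)
    (fun j => by by_cases hj : Even j <;> simp [hj]) x x
    (hxinj.mono fun i hi => by simpa using hi) (hxinj.mono fun i hi => by simpa using hi)
    (fun i hi => Finset.disjoint_left.1 hA1 ((hxA _).2 ⟨i, Finset.mem_range.1 hi, rfl⟩))
    (fun i hi => Finset.disjoint_left.1 hA1 ((hxA _).2 ⟨i, Finset.mem_range.1 hi, rfl⟩))
  have hdiv : ∀ i < N, i / k < m := fun i hi => Nat.div_lt_of_lt_mul (by rwa [mul_comm])
  have hmod : ∀ i, i % k < k := fun i => Nat.mod_lt _ hkpos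
  -- All cycles are numbered consecutively: i / k is the cycle and i % k the position in it. Odd
  -- inner vertices are the y, even ones the z, and w serves as z N.
  set y : ℕ → V := fun i => G (i / k) (2 * (i % k) + 1) with hy
  set z : ℕ → V := fun i => if i < N then G (i / k) (2 * (i % k) + 2) else w with hz
  have hzlt : ∀ i < N, z i = G (i / k) (2 * (i % k) + 2) := fun i hi => if_pos hi
  have hzN : z N = w := if_neg (lt_irrefl _)
  have hidx : ∀ c < m, ∀ i < k, c * k + i < N ∧ (c * k + i) / k = c ∧ (c * k + i) % k = i := by
    intro c hc i hi
    refine ⟨?_, ?_, ?_⟩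
    · calc c * k + i < c * k + k := by omega
        _ = (c + 1) * k := by ring
        _ ≤ m * k := Nat.mul_le_mul_right k hc
    · rw [mul_comm, Nat.mul_add_div hkpos, Nat.div_eq_of_lt hi, add_zero]
    · rw [mul_comm, Nat.mul_add_mod, Nat.mod_eq_of_lt hi]
  have hGinj : ∀ i < N, ∀ j < N, ∀ a ∈ Set.Icc 1 (2 * k), ∀ b ∈ Set.Icc 1 (2 * k),
      G (i / k) a = G (j / k) b → i / k = j / k ∧ a = b := by
    intro i hi j hj a ha b hb heq
    simp only [Set.mem_Icc] at ha hb
    exact (hG _ (Finset.mem_range.2 (hdiv i hi))).2.2.2.2 _ (Finset.mem_range.2 (hdiv j hj))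
      a (by simp only [Set.mem_Icc]; omega) b (by simp only [Set.mem_Icc]; omega) heq
  have hG1 : ∀ i < N, ∀ a ∈ Set.Icc 1 (2 * k), G (i / k) a ∈ K₁ := by
    intro i hi a ha
    simp only [Set.mem_Icc] at ha
    exact (hG _ (Finset.mem_range.2 (hdiv i hi))).2.2.2.1 a
      (by simp only [Set.mem_Icc]; omega)
  have hIy : ∀ i, 2 * (i % k) + 1 ∈ Set.Icc 1 (2 * k) := fun i => by
    have := hmod i
    simp only [Set.mem_Icc]; omega
  have hIz : ∀ i, 2 * (i % k) + 2 ∈ Set.Icc 1 (2 * k) := fun i => by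
    have := hmod i
    simp only [Set.mem_Icc]; omega
  have hy1 : ∀ i < N, y i ∈ K₁ := fun i hi => hG1 i hi _ (hIy i)
  have hz1 : ∀ i < N, z i ∈ K₁ := fun i hi => by rw [hzlt i hi]; exact hG1 i hi _ (hIz i)
  have hzle : ∀ i ≤ N, z i ∈ K₁ ∨ z i = w := fun i hi => by
    rcases hi.lt_or_eq with h' | rfl
    · exact Or.inl (hz1 i h')
    · exact Or.inr hzN
  have hyinj : ∀ i < N, ∀ j < N, y i = y j → i = j := by
    intro i hi j hj heq
    obtain ⟨e1, e2⟩ := hGinj i hi j hj _ (hIy i) _ (hIy j) heq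
    rw [← Nat.div_add_mod i k, ← Nat.div_add_mod j k, e1, show i % k = j % k by omega]
  have hzinj : ∀ i ≤ N, ∀ j ≤ N, z i = z j → i = j := by
    intro i hi j hj heq
    rcases hi.lt_or_eq with hi | rfl <;> rcases hj.lt_or_eq with hj | hj
    · rw [hzlt i hi, hzlt j hj] at heq
      obtain ⟨e1, e2⟩ := hGinj i hi j hj _ (hIz i) _ (hIz j) heq
      rw [← Nat.div_add_mod i k, ← Nat.div_add_mod j k, e1, show i % k = j % k by omega]
    · subst hj
      exact absurd (by rw [← hzN, ← heq]; exact hz1 i hi) hw1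
    · exact absurd (by rw [← hzN, heq]; exact hz1 j hj) hw1
    · exact hj.symm
  have hyz : ∀ i < N, ∀ j ≤ N, y i ≠ z j := by
    intro i hi j hj heq
    rcases hj.lt_or_eq with hj | rfl
    · rw [hzlt j hj] at heq
      have := (hGinj i hi j hj _ (hIy i) _ (hIz j) heq).2
      omega
    · exact hw1 (by rw [← hzN, ← heq]; exact hy1 i hi)
  obtain ⟨Q, hQ⟩ := h₂ (Finset.range N) (by rw [Finset.card_range]) (fun _ => D.Adj)
    (fun _ => Or.inl rfl) y (fun i => z (i + 1))
    (fun i hi j hj => hyinj i (by simpa using hi) j (by simpa using hj))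
    (fun i hi j hj heq => by
      have hi' : i < N := by simpa using hi
      have hj' : j < N := by simpa using hj
      have := hzinj (i + 1) hi' (j + 1) hj' heq
      omega)
    (fun i hi => Finset.disjoint_left.1 h12 (hy1 i (by simpa using hi)))
    (fun i hi => by
      rcases hzle (i + 1) (Finset.mem_range.1 hi) with h' | h'
      · exact Finset.disjoint_left.1 h12 h'
      · rw [h']; exact hw2)
  set seg : ℕ → List V := fun i => (List.range (2 * k)).map (fun a => Q i (a + 1)) with hseg
  have hmemseg : ∀ i, ∀ v ∈ seg i, ∃ a ∈ Set.Icc 1 (2 * (2 * h) + 2), Q i a = v := by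
    intro i v hv
    obtain ⟨a, ha, rfl⟩ := List.mem_map.1 hv
    have := List.mem_range.1 ha
    exact ⟨a + 1, by simp only [Set.mem_Icc]; omega, rfl⟩
  have hsegK : ∀ i < N, ∀ v ∈ seg i, v ∈ K₂ := by
    intro i hi v hv
    obtain ⟨a, ha, rfl⟩ := hmemseg i v hv
    exact (hQ i (Finset.mem_range.2 hi)).2.2.2.1 a ha
  have hsegnodup : ∀ i < N, (seg i).Nodup := by
    intro i hi
    rw [hseg, List.nodup_map_iff_inj_on List.nodup_range]
    intro a ha b hb heq
    rw [List.mem_range] at ha hb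
    have := ((hQ i (Finset.mem_range.2 hi)).2.2.2.2 i (Finset.mem_range.2 hi) (a + 1)
      (by simp only [Set.mem_Icc]; omega) (b + 1) (by simp only [Set.mem_Icc]; omega) heq).2
    omega
  have hsegdisj : ∀ i < N, ∀ j < N, ∀ v, v ∈ seg i → v ∈ seg j → i = j := by
    intro i hi j hj v hv hv'
    obtain ⟨a, ha, rfl⟩ := hmemseg i v hv
    obtain ⟨b, hb, heq⟩ := hmemseg j _ hv'
    exact ((hQ i (Finset.mem_range.2 hi)).2.2.2.2 j (Finset.mem_range.2 hj) a ha b hb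
      heq.symm).1
  have hzK2 : ∀ i ≤ N, z i ∉ K₂ := fun i hi => by
    rcases hzle i hi with h' | h'
    · exact Finset.disjoint_left.1 h12 h'
    · rw [h']; exact hw2
  have hyK2 : ∀ i < N, y i ∉ K₂ := fun i hi => Finset.disjoint_left.1 h12 (hy1 i hi)
  set l := z 0 :: (List.range N).flatMap (fun i => y i :: (seg i ++ [z (i + 1)])) with hl
  have hmeml : ∀ v ∈ l, v ∈ K₁ ∨ v ∈ K₂ ∨ v = w := by
    intro v hv
    rw [hl, List.mem_cons, List.mem_flatMap] at hv
    rcases hv with rfl | ⟨i, hi, hv⟩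
    · rcases hzle 0 (Nat.zero_le _) with h' | h'
      · exact Or.inl h'
      · exact Or.inr (Or.inr h')
    · rw [List.mem_range] at hi
      rw [List.mem_cons, List.mem_append, List.mem_singleton] at hv
      rcases hv with rfl | hv | rfl
      · exact Or.inl (hy1 i hi)
      · exact Or.inr (Or.inl (hsegK i hi v hv))
      · rcases hzle (i + 1) hi with h' | h'
        · exact Or.inl h'
        · exact Or.inr (Or.inr h')
  have hnodup : l.Nodup := by
    rw [hl, List.nodup_cons, List.nodup_flatMap]
    refine ⟨?_, ?_, ?_⟩
    · rw [List.mem_flatMap]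
      rintro ⟨i, hi, hv⟩
      rw [List.mem_range] at hi
      rw [List.mem_cons, List.mem_append, List.mem_singleton] at hv
      rcases hv with hv | hv | hv
      · exact hyz i hi 0 (Nat.zero_le _) hv.symm
      · exact hzK2 0 (Nat.zero_le _) (hsegK i hi _ hv)
      · have := hzinj 0 (Nat.zero_le _) (i + 1) hi hv
        omega
    · intro i hi
      rw [List.mem_range] at hi
      rw [List.nodup_cons, List.mem_append, List.mem_singleton, List.nodup_append]
      refine ⟨?_, hsegnodup i hi, List.nodup_singleton _, ?_⟩
      · rintro (hv | hv)
        · exact hyK2 i hi (hsegK i hi _ hv)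
        · exact hyz i hi (i + 1) hi hv
      · intro a ha b hb hab
        rw [List.mem_singleton] at hb
        exact hzK2 (i + 1) hi (by rw [← hb, ← hab]; exact hsegK i hi a ha)
    · refine List.Pairwise.imp_of_mem ?_ (List.pairwise_lt_range (n := N))
      intro i j hi hj hij v hv hv'
      rw [List.mem_range] at hi hj
      rw [List.mem_cons, List.mem_append, List.mem_singleton] at hv hv'
      rcases hv with rfl | hv | rfl <;> rcases hv' with hv' | hv' | hv'
      · exact hij.ne (hyinj i hi j hj hv')
      · exact hyK2 i hi (hsegK j hj _ hv')
      · exact hyz i hi (j + 1) hj hv'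
      · exact hyK2 j hj (by rw [← hv']; exact hsegK i hi _ hv)
      · exact hij.ne (hsegdisj i hi j hj v hv hv')
      · exact hzK2 (j + 1) hj (by rw [← hv']; exact hsegK i hi _ hv)
      · exact hyz j hj (i + 1) hi hv'.symm
      · exact hzK2 (i + 1) hi (hsegK j hj _ hv')
      · have := hzinj (i + 1) hi (j + 1) hj hv'
        omega
  have habs := exists_absorption D m h x y z seg ?_ ?_ ?_ ?_ ?_ hxinj hl hnodup ?_
  · exact ⟨l, habs.1, hmeml, fun W hW => habs.2 W fun v hv => (hxA v).1 (hW hv)⟩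
  · intro i hi
    rw [hzlt i hi]
    have := (hG _ (Finset.mem_range.2 (hdiv i hi))).2.2.1 (2 * (i % k) + 1)
      (by have := hmod i; omega)
    rw [if_neg (by rw [Nat.not_even_iff_odd]; exact ⟨_, rfl⟩)] at this
    exact this
  · intro c hc i hi
    obtain ⟨a1, a2, a3⟩ := hidx c hc i (by omega)
    obtain ⟨b1, b2, b3⟩ := hidx c hc (i + 1) (by omega)
    rw [← hk, hzlt _ a1, hy]
    simp only
    rw [a2, a3, add_assoc, b2, b3]
    have := (hG _ (Finset.mem_range.2 hc)).2.2.1 (2 * i + 2) (by omega)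
    rw [if_pos ⟨i + 1, by ring⟩] at this
    exact this
  · intro c hc
    obtain ⟨a1, a2, a3⟩ := hidx c hc 0 (by omega)
    rw [add_zero] at a1 a2 a3
    rw [← hk, hy]
    simp only
    rw [a2, a3]
    have := (hG _ (Finset.mem_range.2 hc)).2.2.1 0 (by omega)
    rw [if_pos ⟨0, rfl⟩, (hG _ (Finset.mem_range.2 hc)).1] at this
    exact this
  · intro c hc
    obtain ⟨a1, a2, a3⟩ := hidx c hc (2 * h) (by omega)
    rw [← hk, hzlt _ a1, a2, a3]
    have := (hG _ (Finset.mem_range.2 hc)).2.2.1 (2 * (2 * h) + 2) (by omega)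
    rw [if_pos ⟨2 * h + 1, by ring⟩, (hG _ (Finset.mem_range.2 hc)).2.1] at this
    exact this
  · intro i hi
    obtain ⟨q0, qN, qr, -, -⟩ := hQ i (Finset.mem_range.2 hi)
    have := IsWalk.map_range (R := D.Adj) (f := Q i) (2 * (2 * h) + 3) qr
    rw [q0, qN, List.range_succ, List.map_append, List.map_singleton, qN] at this
    exact this
  · intro c hc hcl
    have hcA := (hxA (x c)).2 ⟨c, hc, rfl⟩
    rcases hmeml _ hcl with h' | h' | h'
    · exact Finset.disjoint_left.1 hA1 hcA h'
    · exact Finset.disjoint_left.1 hA2 hcA h'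
    · exact hwA (h' ▸ hcA)

/-! ### Parameters for pseudorandom digraphs. -/

theorem arcCount_eq_relCount (D : Digraph V) (X Y : Finset V) :
    arcCount D X Y = relCount D.Adj X Y := by
  simp only [arcCount, relCount, Finset.card_filter, Finset.sum_product]

theorem IsPseudorandom.sparse [Fintype V] {D : Digraph V} {n : ℕ} {α p : ℝ}
    (h : IsPseudorandom D n α p) :
    Sparse D.Adj (Real.log n ^ 2 / p) (Real.log n ^ (2.1 : ℝ)) (Real.log n ^ (1.1 : ℝ) / p)
      ((1 + α / 2) * p) where
  few X hX := by
    rw [← arcCount_eq_relCount, mul_comm]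
    exact h.few_arcs X hX
  between X Y hd hX hY := by
    rw [← arcCount_eq_relCount]
    exact (h.arcs_between X Y hd hX hY).trans_eq (by ring)

/-- Degrees are at most n, so np/2 ≤ n. An upper bound on p is needed for the threshold L ^ 1.1 / p
to be at least 1. -/
theorem IsPseudorandom.density_le_two [Fintype V] {D : Digraph V} {n : ℕ} {α p : ℝ}
    (h : IsPseudorandom D n α p) (hα : 0 < α) (hp : 0 < p) (hn : 0 < n) : p ≤ 2 := by
  obtain ⟨v⟩ := Fintype.card_pos_iff.1 (h.card_eq.symm ▸ hn)
  have h1 := h.min_degree v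
  have h2 : minSemidegree D v Finset.univ ≤ n := by
    rw [← h.card_eq]
    exact (min_le_left _ _).trans (Finset.card_le_univ _)
  have h3 : (minSemidegree D v Finset.univ : ℝ) ≤ n := by exact_mod_cast h2
  have hn' : (0 : ℝ) < n := by exact_mod_cast hn
  have h4 : (1 / 2) * p * n ≤ 1 * n := by nlinarith [mul_pos (mul_pos hα hn') hp]
  have := le_of_mul_le_mul_right h4 hn'
  linarith

theorem rpow_le_pow_of_le {L : ℝ} (hL : 1 ≤ L) {a : ℝ} {k : ℕ} (h : a ≤ k) : L ^ a ≤ L ^ k := by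
  rw [← Real.rpow_natCast]
  exact Real.rpow_le_rpow_of_exponent_le hL h

theorem mul_rpow_le_sq {L : ℝ} (hL : 14400 ≤ L) : 120 * L ^ (1.1 : ℝ) ≤ L ^ 2 := by
  have hL0 : 0 < L := by linarith
  have h1 : L ^ (1.1 : ℝ) ≤ L ^ (1.5 : ℝ) :=
    Real.rpow_le_rpow_of_exponent_le (by linarith) (by norm_num)
  have h2 : (120 : ℝ) ≤ L ^ (0.5 : ℝ) := by
    rw [show (0.5 : ℝ) = 1 / 2 by norm_num, ← Real.sqrt_eq_rpow]
    exact Real.le_sqrt_of_sq_le (by linarith)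
  calc 120 * L ^ (1.1 : ℝ) ≤ L ^ (0.5 : ℝ) * L ^ (1.5 : ℝ) := by gcongr
    _ = L ^ 2 := by
      rw [← Real.rpow_add hL0, ← Real.rpow_natCast]
      norm_num

/-- Dense parts of a pseudorandom digraph connect almost linearly many pairs. -/
theorem IsPseudorandom.connects [Fintype V] {D : Digraph V} {n : ℕ} {α p β L : ℝ}
    (h : IsPseudorandom D n α p) (hLn : L = Real.log n) (hα : 0 < α) (hp : 0 < p) (hp2 : p ≤ 2)
    (hn : 0 < n) (hL : 14400 ≤ L) (hβL : 30 < β * L) (hαβL : 2000 * (1 + α) ≤ α * β * L)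
    (hnp : L ^ 8 ≤ n * p) {K : Finset V} (hK : β * n ≤ K.card)
    (hdeg : ∀ v, (1 / 2 + α) * K.card * p ≤ (minSemidegree D v K : ℝ))
    {N J : ℕ} (hN : (N : ℝ) ≤ 10 * (n / L ^ 2)) (hJ : (J : ℝ) ≤ 4 * L)
    (hJ1 : L ^ (1.1 : ℝ) / p ≤ 2 ^ J) (hJ2 : (2 : ℝ) ^ J ≤ 4 * (L ^ (1.1 : ℝ) / p)) :
    Connects D K N J := by
  intro S hS rel hrel s t hs ht hsK htK
  have hsp := h.sparse
  rw [← hLn] at hsp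
  have hL0 : 0 < L := by linarith
  have hL1 : 1 ≤ L := by linarith
  have hn0 : (0 : ℝ) < n := by exact_mod_cast hn
  have hβ : 0 < β := by
    by_contra! hcon
    nlinarith
  set κ : ℝ := (K.card : ℝ) with hκ
  have hyκ : β * (n * p) ≤ κ * p := by nlinarith
  have hy : 0 < n * p := by positivity
  have hκp : 0 < κ * p := lt_of_lt_of_le (by positivity) hyκ
  have hrp : L ^ (1.1 : ℝ) ≤ L ^ 2 := rpow_le_pow_of_le hL1 (by norm_num)
  have hlam : L ^ (2.1 : ℝ) ≤ L ^ 3 := rpow_le_pow_of_le hL1 (by norm_num)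
  have hlam0 : 0 ≤ L ^ (2.1 : ℝ) := by positivity
  have hrp0 : 0 ≤ L ^ (1.1 : ℝ) := by positivity
  -- Yardstick for the error terms: each is at most a constant, possibly times 1 + α, times Y, while
  -- |K|p ≥ βL · Y is larger by a factor of order L.
  set Y : ℝ := n * p / L with hY
  have hYL : Y * L = n * p := by rw [hY]; field_simp
  have hY0 : 0 < Y := by positivity
  have h34 : L ^ 3 ≤ L ^ 4 := pow_le_pow_right₀ hL1 (by norm_num)
  have h4Y : L ^ 4 ≤ Y := by
    rw [hY, le_div_iff₀ hL0]
    calc L ^ 4 * L = L ^ 5 := by ring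
      _ ≤ L ^ 8 := pow_le_pow_right₀ hL1 (by norm_num)
      _ ≤ _ := hnp
  have hlamY : L ^ (2.1 : ℝ) ≤ Y := by linarith
  have hαY : 2000 * (1 + α) * Y ≤ α * (κ * p) := by
    calc 2000 * (1 + α) * Y ≤ α * β * L * Y := by gcongr
      _ = α * (β * (n * p)) := by rw [← hYL]; ring
      _ ≤ α * (κ * p) := by gcongr
  have hβY : 30 * Y < κ * p := by
    calc 30 * Y < β * L * Y := by gcongr
      _ = β * (n * p) := by rw [← hYL]; ring
      _ ≤ κ * p := hyκ
  have hJ0 : (0 : ℝ) ≤ J := by positivity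
  have hSN : (S.card : ℝ) ≤ N := by exact_mod_cast hS
  have hu : (4 * J + 4) * (S.card : ℝ) ≤ 200 * (n / L) := by
    have h1 : (4 * J + 4 : ℝ) ≤ 20 * L := by linarith
    calc (4 * J + 4) * (S.card : ℝ) ≤ 20 * L * (10 * (n / L ^ 2)) := by
          have := hSN.trans hN
          gcongr
      _ = 200 * (n / L) := by field_simp; ring
  have hTn : L ^ (1.1 : ℝ) / p ≤ n / L := by
    rw [div_le_div_iff₀ hp hL0]
    calc L ^ (1.1 : ℝ) * L ≤ L ^ 2 * L := by gcongr
      _ = L ^ 3 := by ring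
      _ ≤ L ^ 8 := pow_le_pow_right₀ hL1 (by norm_num)
      _ ≤ _ := hnp
  have hnL : 300 * (n / L) ≤ n := by
    rw [← mul_div_assoc, div_le_iff₀ hL0]
    nlinarith
  have hunp : (1 + α / 2) * p * (200 * (n / L)) = 200 * (1 + α / 2) * Y := by
    rw [hY]; ring
  have hαY0 : 0 < α * Y := by positivity
  have hsemi : ∀ x, (1 / 2 + α) * κ * p ≤ ((K.filter (D.Adj x)).card : ℝ) ∧
      (1 / 2 + α) * κ * p ≤ ((K.filter (flip D.Adj x)).card : ℝ) := by
    intro x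
    have h1 : minSemidegree D x K ≤ (K.filter (D.Adj x)).card := min_le_left _ _
    have h2 : minSemidegree D x K ≤ (K.filter (flip D.Adj x)).card := min_le_right _ _
    exact ⟨(hdeg x).trans (by exact_mod_cast h1), (hdeg x).trans (by exact_mod_cast h2)⟩
  -- The degree (1/2 + α)κp is split into d, which survives the deletion, and q = ακp/2, which may
  -- be lost. Then 2b = ακp/3 < q, and d exceeds γκ/2 by ακp/4.
  refine hsp.exists_disjoint_paths (d := (1 / 2 + α / 2) * κ * p) (q := α / 2 * κ * p)
    (b := α / 6 * (κ * p)) (κ := κ) (u := 200 * (n / L)) (C := 8 * J + 8) ?_ hlam0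
    (by positivity) S J hJ1 ?_ rfl hu ?_ ?_ ?_ ?_ ?_ ?_ ?_ le_rfl ?_ hrel hs ht hsK htK
  · rw [le_div_iff₀ hp, one_mul]
    have : L ^ (1 : ℝ) ≤ L ^ (1.1 : ℝ) :=
      Real.rpow_le_rpow_of_exponent_le hL1 (by norm_num)
    rw [Real.rpow_one] at this
    linarith
  · calc 30 * (2 : ℝ) ^ J ≤ 120 * L ^ (1.1 : ℝ) / p := by
          rw [mul_div_assoc]; linarith
      _ ≤ _ := by
        gcongr
        exact mul_rpow_le_sq hL
  · rw [h.card_eq]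
    linarith
  · rw [hunp]
    linarith only [hlamY, hαY, hY0, hαY0]
  · have h1 : (1 + (8 * J + 8) : ℝ) ≤ 41 * L := by linarith
    calc L ^ (2.1 : ℝ) * (1 + (8 * J + 8)) ≤ L ^ 3 * (41 * L) := by gcongr
      _ = 41 * L ^ 4 := by ring
      _ ≤ α / 6 * (κ * p) := by linarith only [h4Y, hαY, hY0, hαY0]
  · have h1 : (8 * J + 8 : ℝ) ≤ 40 * L := by linarith
    have h2 : 2 * ((1 + α / 2) * p) * (L ^ (1.1 : ℝ) / p) * (8 * J + 8) ≤
        80 * (1 + α / 2) * Y := by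
      calc 2 * ((1 + α / 2) * p) * (L ^ (1.1 : ℝ) / p) * (8 * J + 8)
          = 2 * (1 + α / 2) * (L ^ (1.1 : ℝ) * (8 * J + 8)) := by field_simp
        _ ≤ 2 * (1 + α / 2) * (L ^ 2 * (40 * L)) := by gcongr
        _ = 80 * (1 + α / 2) * L ^ 3 := by ring
        _ ≤ 80 * (1 + α / 2) * Y := by
          have : L ^ 3 ≤ Y := h34.trans h4Y
          gcongr
    linarith only [h2, hlamY, hαY, hY0, hαY0]
  · linarith only [mul_pos hα hκp]
  · linarith only [hlamY, hβY, mul_pos hα hκp, hY0]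
  · linarith only [hlamY, hαY, hY0, hαY0]
  · intro x
    have : (1 / 2 + α / 2) * κ * p + α / 2 * κ * p = (1 / 2 + α) * κ * p := by ring
    rw [this]
    exact hsemi x

/-- A power of four of the order of `T`, with exponent at most logarithmic in a bound for `T`. -/
theorem exists_four_pow_near {T n L : ℝ} (hT : 1 ≤ T) (hTn : T ≤ n) (hL : L = Real.log n)
    (hL1 : 1 ≤ L) : ∃ h : ℕ, T ≤ 2 ^ (2 * h) ∧ (2 : ℝ) ^ (2 * h) ≤ 4 * T ∧ (h : ℝ) ≤ 2 * L := by
  obtain ⟨k, hk1, hk2⟩ := exists_nat_pow_near hT (by norm_num : (1 : ℝ) < 4)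
  have h4 : ∀ j : ℕ, (2 : ℝ) ^ (2 * j) = 4 ^ j := fun j => by rw [pow_mul]; norm_num
  refine ⟨k + 1, by rw [h4]; exact hk2.le, by rw [h4, pow_succ]; linarith, ?_⟩
  have h1 : 1 ≤ Real.log 4 := by
    rw [Real.le_log_iff_exp_le (by norm_num)]
    linarith [Real.exp_one_lt_d9]
  have h2 : Real.log (4 ^ k) ≤ Real.log n := Real.log_le_log (by positivity) (hk1.trans hTn)
  rw [Real.log_pow, ← hL] at h2
  have h3 : (k : ℝ) ≤ L := by nlinarith [(Nat.cast_nonneg k : (0 : ℝ) ≤ k)]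
  push_cast
  linarith

/-- Taking 2 ^ J near T with J = 2j even makes each cycle have an odd number 2j + 1 of blocks, hence
the power of four. There are at most (2n/L³) · 5L = 10n/L² pairs to join, few enough for
`IsPseudorandom.connects`. -/
theorem IsPseudorandom.exists_absorbing_path [Fintype V] {D : Digraph V} {n : ℕ} {α p ε L : ℝ}
    (h : IsPseudorandom D n α p) (hLn : L = Real.log n) (hα : 0 < α) (hp : 0 < p)
    (hn : 0 < n) (hL : 14400 ≤ L) (hβL : 30 < α / (5 * (1 + 2 * α)) * L)
    (hαβL : 2000 * (1 + α) ≤ α * (α / (5 * (1 + 2 * α))) * L)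
    (hnp : L ^ 8 ≤ n * p) (hε : ε ≤ 1) {P : Fin 5 → Finset V}
    (hP : IsGoodPartition D n α p ε P) :
    ∃ l : List V, IsDirectedPath D l ∧ (∀ v ∈ l, v ∈ P 1 ∨ v ∈ P 2 ∨ v ∈ P 3) ∧
      ∀ W : Finset V, W ⊆ P 0 → ∃ l' : List V, IsDirectedPath D l' ∧
        (∀ v, v ∈ l' ↔ v ∈ l ∨ v ∈ W) ∧ SameEndpoints l' l := by
  have hn0 : (0 : ℝ) < n := by exact_mod_cast hn
  have hL0 : 0 < L := by linarith
  have hL1 : 1 ≤ L := by linarith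
  have hp2 := h.density_le_two hα hp hn
  have hT1 : 1 ≤ L ^ (1.1 : ℝ) / p := by
    rw [le_div_iff₀ hp, one_mul]
    have : L ^ (1 : ℝ) ≤ L ^ (1.1 : ℝ) :=
      Real.rpow_le_rpow_of_exponent_le hL1 (by norm_num)
    rw [Real.rpow_one] at this
    linarith
  have hTn : L ^ (1.1 : ℝ) / p ≤ n := by
    rw [div_le_iff₀ hp]
    calc L ^ (1.1 : ℝ) ≤ L ^ 8 := rpow_le_pow_of_le hL1 (by norm_num)
      _ ≤ _ := hnp
  obtain ⟨j, hj1, hj2, hj3⟩ := exists_four_pow_near hT1 hTn hLn hL1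
  have hP0 : ((P 0).card : ℝ) ≤ 2 * (n / L ^ 3) := by
    have h1 := (abs_le.1 hP.card_first).2
    rw [← hLn] at h1
    have h2 : 0 ≤ n / L ^ 3 := by positivity
    nlinarith
  have hN : (((P 0).card * (2 * j + 1) : ℕ) : ℝ) ≤ 10 * (n / L ^ 2) := by
    push_cast
    calc ((P 0).card : ℝ) * (2 * j + 1) ≤ 2 * (n / L ^ 3) * (5 * L) := by
          have : (2 * j + 1 : ℝ) ≤ 5 * L := by linarith
          gcongr
      _ = 10 * (n / L ^ 2) := by field_simp; ring
  have hcon : ∀ i ∈ ({1, 2, 3} : Finset (Fin 5)),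
      Connects D (P i) ((P 0).card * (2 * j + 1)) (2 * j) := fun i hi =>
    h.connects hLn hα hp hp2 hn hL hβL hαβL hnp (hP.card_middle i hi).1.le
      (fun v => hP.min_degree v i) hN (by push_cast; linarith) hj1 hj2
  obtain ⟨w, hw⟩ : (P 3).Nonempty := by
    rw [← Finset.card_pos]
    have h1 := (hP.card_middle 3 (by simp)).1
    have h2 : 0 < α / (5 * (1 + 2 * α)) * n := by positivity
    exact_mod_cast h2.trans h1
  have hw' : ∀ i, i ≠ 3 → w ∉ P i := fun i hi hwi =>
    Finset.disjoint_left.1 (hP.disjoint i 3 hi) hwi hw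
  obtain ⟨l, hl, hlP, hlW⟩ := Connects.exists_absorbing_path D (hcon 1 (by simp))
    (hcon 2 (by simp)) (hP.disjoint 0 1 (by decide)) (hP.disjoint 0 2 (by decide))
    (hP.disjoint 1 2 (by decide)) (hw' 0 (by decide)) (hw' 1 (by decide)) (hw' 2 (by decide))
  refine ⟨l, hl, fun v hv => ?_, hlW⟩
  rcases hlP v hv with h' | h' | rfl
  · exact Or.inl h'
  · exact Or.inr (Or.inl h')
  · exact Or.inr (Or.inr hw)

end PseudorandomDigraph

end

theorem mainTheorem4 (α : ℝ) (hα : 0 < α) (p : ℕ → ℝ)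
    (hp : Tendsto (fun n : ℕ => p n / (Real.log n ^ 8 / n)) atTop atTop)
    (ε : ℕ → ℝ) (hε : Tendsto ε atTop (nhds 0)) :
    ∀ᶠ n : ℕ in atTop, ∀ (V : Type*) [Fintype V] (D : Digraph V),
      PseudorandomDigraph.IsPseudorandom D n α (p n) →
      ∀ P : Fin 5 → Finset V, PseudorandomDigraph.IsGoodPartition D n α (p n) (ε n) P →
        ∃ l : List V, PseudorandomDigraph.IsDirectedPath D l ∧
          (∀ v ∈ l, v ∈ P 1 ∨ v ∈ P 2 ∨ v ∈ P 3) ∧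
          ∀ W : Finset V, W ⊆ P 0 →
            ∃ l' : List V, PseudorandomDigraph.IsDirectedPath D l' ∧
              (∀ v, v ∈ l' ↔ v ∈ l ∨ v ∈ W) ∧
              PseudorandomDigraph.SameEndpoints l' l := by
  have hlog : Tendsto (fun n : ℕ => Real.log n) atTop atTop :=
    Real.tendsto_log_atTop.comp tendsto_natCast_atTop_atTop
  have hβ : 0 < α / (5 * (1 + 2 * α)) := by positivity
  filter_upwards [hlog.eventually_ge_atTop 14400,
    (hlog.const_mul_atTop hβ).eventually_gt_atTop 30,
    (hlog.const_mul_atTop (mul_pos hα hβ)).eventually_ge_atTop (2000 * (1 + α)),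
    hp.eventually_ge_atTop 1, hε.eventually_le_const one_pos, eventually_gt_atTop 0]
    with n h1 h2 h3 h4 h5 hn V _ D hD P hP
  have hn0 : (0 : ℝ) < n := by exact_mod_cast hn
  have hL8 : 0 < Real.log n ^ 8 / n := by
    have : 0 < Real.log n := by linarith
    positivity
  rw [le_div_iff₀ hL8, one_mul] at h4
  exact hD.exists_absorbing_path rfl hα (hL8.trans_le h4) hn h1 h2 h3
    (by rwa [div_le_iff₀ hn0, mul_comm] at h4) h5 hP
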